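/- **Proposition (fourth order Schrödinger equation).** Let $n\ge 1$ and let $\Phi:\mathbb R^n\to[0,1]$ be smooth and radial with $\operatorname{supp}\Phi\subseteq\{|x|\le 2\}$ and $\Phi(x)=1$ for $|x|\le 1$. Put $\psi(x)=\Phi(x)-\Phi(2x)$, and let $P_{\le 0}$ and $\triangle_k$ be the Fourier multipliers on $\mathcal S'(\mathbb R^n)$ with symbols $\Phi(\xi)$ and $\psi(2^{-k}\xi)$ (Fourier transform with kernel $e^{-ix\cdot\xi}$). For $s\in\mathbb R$ and $1\le p,q\le\infty$ let $$\|f\|_{B^s_{p,q}}=\Big(\|P_{\le 0}f\|_{L^p}^q+\sum_{k=1}^\infty 2^{ksq}\|\triangle_k f\|_{L^p}^q\Big)^{1/q}\in[0,\infty],\qquad f\in\mathcal S'(\mathbb R^n)$$ (supremum of the terms $\|P_{\le 0}f\|_{L^p}$, $2^{ks}\|\triangle_kf\|_{L^p}$ if $q=\infty$), and let $B^s_{p,q}$ be the space of those $f$ for which it is finite. Let $U(t)=e^{it(\Delta^2-\Delta)}$ be the Fourier multiplier with symbol $e^{it(|\xi|^4+|\xi|^2)}$. There is a constant $C$, depending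 only on $n$ and $\Phi$, such that the following holds. Let $2\le p\le\infty$, $\frac1p+\frac1{p'}=1$, $1\le q\le\infty$, $\delta=\frac12-\frac1p$, and let $s,s'\in\mathbb R$ satisfy $-2n\delta\le s'-s$. Then for all $t\in\mathbb R$ and all $g\in B^{s'}_{p',q}$, $$\|U(t)g\|_{B^s_{p,q}}\le C\,k(t)\,\|g\|_{B^{s'}_{p',q}},\qquad k(t)=\begin{cases}|t|^{\frac14\min(s'-s-2n\delta,\,0)},& |t|\le 1,\\ |t|^{-n\delta},& |t|> 1,\end{cases}$$ where at $t=0$ we read $k(0)=1$ if the exponent is $0$ and $k(0)=\infty$ (with $\infty\cdot 0=0$) if it is negative. -/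

import Mathlib

open MeasureTheory
open scoped ENNReal NNReal SchwartzMap

noncomputable section

/-- The space `ℝⁿ` with its Euclidean norm. -/
abbrev Rn (n : ℕ) : Type := EuclideanSpace ℝ (Fin n)

/-- A Littlewood-Paley cutoff: a smooth radial (hence even) function with values in `[0, 1]`,
supported in `{|x| ≤ 2}` and equal to `1` on `{|x| ≤ 1}`. -/
structure IsLPCutoff {n : ℕ} (Φ : Rn n → ℝ) : Prop where
  smooth : ContDiff ℝ (⊤ : ℕ∞) Φ
  radial : ∀ x y : Rn n, ‖x‖ = ‖y‖ → Φ x = Φ y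
  mem_Icc : ∀ x, Φ x ∈ Set.Icc (0 : ℝ) 1
  eq_one : ∀ x : Rn n, ‖x‖ ≤ 1 → Φ x = 1
  eq_zero : ∀ x : Rn n, 2 < ‖x‖ → Φ x = 0

/-- The operator `m(D) = 𝓕⁻¹ m 𝓕` on tempered distributions, where `𝓕` is the Fourier transform
with kernel `e^{-i x·ξ}` (so that `-Δ` has the symbol `|ξ|²`). Mathlib's Fourier transform has the
kernel `e^{-2π i x·ξ}`, whence the factor `2π`. -/
def freqMultiplier {n : ℕ} (m : Rn n → ℂ) : 𝓢'(Rn n, ℂ) →L[ℂ] 𝓢'(Rn n, ℂ) :=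
  TemperedDistribution.fourierMultiplierCLM ℂ (fun ξ => m ((2 * Real.pi) • ξ))

/-- The low frequency projector `P_{≤ 0}`, with symbol `Φ(ξ)`. -/
def lowFreq {n : ℕ} (Φ : Rn n → ℝ) : 𝓢'(Rn n, ℂ) →L[ℂ] 𝓢'(Rn n, ℂ) :=
  freqMultiplier (fun ξ => (Φ ξ : ℂ))

/-- `ψ(x) = Φ(x) - Φ(2x)`. -/
def lpBump {n : ℕ} (Φ : Rn n → ℝ) (x : Rn n) : ℝ := Φ x - Φ ((2 : ℝ) • x)

/-- The Littlewood-Paley projector `△_k`, with symbol `ψ(2^{-k} ξ)`. -/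
def lpProj {n : ℕ} (Φ : Rn n → ℝ) (k : ℤ) : 𝓢'(Rn n, ℂ) →L[ℂ] 𝓢'(Rn n, ℂ) :=
  freqMultiplier (fun ξ => (lpBump Φ ((2 : ℝ) ^ (-k) • ξ) : ℂ))

/-- The propagator `U(t) = e^{it(Δ² - Δ)}`, with symbol `e^{it(|ξ|⁴ + |ξ|²)}`. -/
def schrodinger4 {n : ℕ} (t : ℝ) : 𝓢'(Rn n, ℂ) →L[ℂ] 𝓢'(Rn n, ℂ) :=
  freqMultiplier (fun ξ => Complex.exp (((t * (‖ξ‖ ^ 4 + ‖ξ‖ ^ 2) : ℝ) : ℂ) * Complex.I))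

/-- The `Lᵖ` norm of a tempered distribution: the norm of the `Lᵖ` function that represents it
(unique up to null sets), and `∞` if there is none. -/
def distLpNorm {n : ℕ} (p : ℝ≥0∞) (u : 𝓢'(Rn n, ℂ)) : ℝ≥0∞ :=
  ⨅ (f : Rn n → ℂ) (_ : MemLp f p volume) (_ : ∀ g : 𝓢(Rn n, ℂ), u g = ∫ x, g x * f x),
    eLpNorm f p volume

/-- The Besov norm `‖u‖_{B^s_{p,q}}`, equal to `∞` exactly when `u` is not in the Besov space.
The index `k : ℕ` stands for the frequency level `k + 1`. -/
def besovNorm {n : ℕ} (Φ : Rn n → ℝ) (s : ℝ) (p q : ℝ≥0∞) (u : 𝓢'(Rn n, ℂ)) : ℝ≥0∞ :=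
  if q = ⊤ then
    max (distLpNorm p (lowFreq Φ u))
      (⨆ k : ℕ, (2 : ℝ≥0∞) ^ (((k : ℝ) + 1) * s) * distLpNorm p (lpProj Φ ((k : ℤ) + 1) u))
  else
    (distLpNorm p (lowFreq Φ u) ^ q.toReal +
      ∑' k : ℕ, (2 : ℝ≥0∞) ^ (((k : ℝ) + 1) * s * q.toReal) *
        distLpNorm p (lpProj Φ ((k : ℤ) + 1) u) ^ q.toReal) ^ (1 / q.toReal)

/-- The number `δ = 1/2 - 1/p` (with `1/∞ = 0`). -/
def deltaExp (p : ℝ≥0∞) : ℝ := 1 / 2 - (p⁻¹).toReal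

/-- The kernel `k(t)`, as an extended nonnegative number: at `t = 0` it is `∞` if the exponent
is negative and `1` if the exponent is `0`. -/
def decayKernel (n : ℕ) (δ s s' t : ℝ) : ℝ≥0∞ :=
  if |t| ≤ 1 then ENNReal.ofReal |t| ^ (1 / 4 * min (s' - s - 2 * n * δ) 0)
  else ENNReal.ofReal |t| ^ (-(n * δ))

/-! The symbols above have temperate growth, so that `freqMultiplier` is the genuine Fourier
multiplier for each of them. -/

lemma IsLPCutoff.hasCompactSupport {n : ℕ} {Φ : Rn n → ℝ} (h : IsLPCutoff Φ) :
    HasCompactSupport Φ :=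
  HasCompactSupport.intro (isCompact_closedBall (0 : Rn n) 2) fun x hx =>
    h.eq_zero x (by simpa using hx)

lemma IsLPCutoff.scaled_hasTemperateGrowth {n : ℕ} {Φ : Rn n → ℝ} (h : IsLPCutoff Φ) (c : ℝ) :
    (fun ξ : Rn n => (Φ (c • ξ) : ℂ)).HasTemperateGrowth := by
  have h1 : Φ.HasTemperateGrowth := h.hasCompactSupport.hasTemperateGrowth h.smooth
  have h2 : (fun ξ : Rn n => c • ξ).HasTemperateGrowth :=
    (c • ContinuousLinearMap.id ℝ (Rn n)).hasTemperateGrowth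
  exact (Function.Complex.hasTemperateGrowth_ofReal.comp h1).comp h2

lemma IsLPCutoff.lowFreq_symbol_hasTemperateGrowth {n : ℕ} {Φ : Rn n → ℝ} (h : IsLPCutoff Φ) :
    (fun ξ : Rn n => (Φ ((2 * Real.pi) • ξ) : ℂ)).HasTemperateGrowth :=
  h.scaled_hasTemperateGrowth _

lemma IsLPCutoff.lpProj_symbol_hasTemperateGrowth {n : ℕ} {Φ : Rn n → ℝ} (h : IsLPCutoff Φ)
    (k : ℤ) : (fun ξ : Rn n =>
      (lpBump Φ ((2 : ℝ) ^ (-k) • ((2 * Real.pi) • ξ)) : ℂ)).HasTemperateGrowth := by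
  have h1 := (h.scaled_hasTemperateGrowth ((2 : ℝ) ^ (-k) * (2 * Real.pi))).sub
    (h.scaled_hasTemperateGrowth (2 * ((2 : ℝ) ^ (-k) * (2 * Real.pi))))
  convert h1 using 1
  funext ξ
  simp [lpBump, smul_smul]

lemma hasTemperateGrowth_cexp_mul_I :
    (fun x : ℝ => Complex.exp ((x : ℂ) * Complex.I)).HasTemperateGrowth := by
  have hs : ContDiff ℝ (⊤ : ℕ∞) (fun x : ℝ => Complex.exp ((x : ℂ) * Complex.I)) :=
    (Complex.ofRealCLM.contDiff.mul contDiff_const).cexp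
  have hd : ∀ m : ℕ, iteratedDeriv m (fun x : ℝ => Complex.exp ((x : ℂ) * Complex.I)) =
      fun x : ℝ => Complex.I ^ m * Complex.exp ((x : ℂ) * Complex.I) := by
    intro m
    induction m with
    | zero => simp
    | succ m ih =>
      rw [iteratedDeriv_succ, ih]
      funext x
      have h1 : HasDerivAt (fun x : ℝ => (x : ℂ) * Complex.I) (1 * Complex.I) x :=
        (Complex.ofRealCLM.hasDerivAt (x := x)).mul_const Complex.I
      have h2 := (h1.cexp.const_mul (Complex.I ^ m)).deriv
      rw [h2]
      ring
  refine ⟨hs, fun m => ⟨0, 1, fun x => ?_⟩⟩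
  rw [norm_iteratedFDeriv_eq_norm_iteratedDeriv, hd m]
  simp [Complex.norm_exp_ofReal_mul_I]

lemma schrodinger4_symbol_hasTemperateGrowth {n : ℕ} (t : ℝ) :
    (fun ξ : Rn n => Complex.exp (((t * (‖(2 * Real.pi) • ξ‖ ^ 4 + ‖(2 * Real.pi) • ξ‖ ^ 2) : ℝ) :
      ℂ) * Complex.I)).HasTemperateGrowth := by
  have h2 : (fun ξ : Rn n => ‖ξ‖ ^ 2).HasTemperateGrowth :=
    Function.hasTemperateGrowth_norm_sq _
  have h0 : (fun ξ : Rn n => t * ((2 * Real.pi) ^ 4 * (‖ξ‖ ^ 2) ^ 2 +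
      (2 * Real.pi) ^ 2 * ‖ξ‖ ^ 2)).HasTemperateGrowth := by
    fun_prop
  convert hasTemperateGrowth_cexp_mul_I.comp h0 using 1
  funext ξ
  simp only [Function.comp_apply, norm_smul, Real.norm_eq_abs, mul_pow]
  congr 3
  have e2 : |2 * Real.pi| ^ 2 = (2 * Real.pi) ^ 2 := sq_abs _
  have e4 : |2 * Real.pi| ^ 4 = (2 * Real.pi) ^ 4 := by
    rw [show 4 = 2 * 2 from rfl, pow_mul, e2, ← pow_mul]
  simp only [← mul_pow]
  simp only [mul_pow |2 * Real.pi|, e2, e4]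
  ring

end

/-! All the operators are Fourier multipliers and commute, and both Besov norms use the same `q`. It
therefore suffices to bound `U(t)` from `L^{p'}` to `L^p` on each frequency block, with a factor
that the weights `2^{Ks}`, `2^{Ks'}` and `k(t)` absorb. On a block of size `2^K` a slightly wider
cutoff `χ(2^{-K}·)` can be inserted for free, so `U(t)` acts there as convolution with a Schwartz
kernel.

Rescaling frequencies by `2^K` turns the phase into `τ(|η|⁴ + ε|η|²)` with `τ = 2^{4K} t` and `ε =
2^{-2K} ∈ [0, 1]`. The oscillatory integral is bounded by `C|τ|^{-n/2}`, uniformly in `ε` and in the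
linear phase (`exists_norm_sq_integral_quartic_le`). To see this, write its squared modulus as the
integral over `h` of an autocorrelation. The phase difference between `η + h` and `η` is `τ|h|`
times a polynomial whose derivative along `h/|h|` is at least `2(|η|² + ε)`. Non-stationary phase
bounds the inner integral by `(1 + |τh|)^{-n-1}`, and integrating in `h` gives `|τ|^{-n}`. The
quantity `|η|² + ε` is bounded below on an annulus for every `ε`, and everywhere when `ε = 1`, which
covers the low frequency block.

The kernel is thus at most `C 2^{Kn}`, and at most `C 2^{-Kn}|t|^{-n/2}` when `t ≠ 0`. Interpolating
the resulting `L¹ → L^∞` bound with the `L²` contraction (`eLpNorm_convOp_le`) raises it to the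
power `2δ`, giving `2^{2Knδ}` or `2^{-2Knδ}|t|^{-nδ}`. For `|t| ≤ 1` and a negative exponent in
`k(t)`, the first is used when `2^{4K}|t| ≤ 1` and the second otherwise; for `|t| > 1` the second
always suffices (`exists_factor_le_decayKernel`). -/

noncomputable section

/-! ### Non-stationary phase -/

section IteratedAmplitude

variable {E : Type*} [NormedAddCommGroup E] [NormedSpace ℝ E]

variable {P : Type*} [NormedAddCommGroup P] [NormedSpace ℝ P]

/-- The iterated amplitudes produced by repeated integration by parts. -/
def ibpAmplitude (e : P → E) (G a : P × E → ℝ) : ℕ → P × E → ℝ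
  | 0 => a
  | k + 1 => fun w => fderiv ℝ (fun z => ibpAmplitude e G a k z * G z) w (0, e w.1)

lemma contDiff_ibpAmplitude {e : P → E} {G a : P × E → ℝ} (he : ContDiff ℝ (⊤ : ℕ∞) e)
    (hG : ContDiff ℝ (⊤ : ℕ∞) G) (ha : ContDiff ℝ (⊤ : ℕ∞) a) (k : ℕ) :
    ContDiff ℝ (⊤ : ℕ∞) (ibpAmplitude e G a k) := by
  induction k with
  | zero => exact ha
  | succ k ih =>
    exact ((ih.mul hG).fderiv_right (m := (⊤ : ℕ∞)) (by simp)).clm_apply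
      (contDiff_const.prodMk (he.comp contDiff_fst))

/-- The amplitudes are differentiated jointly in parameter and variable, so that they are continuous
in both and compactness gives uniform bounds. This returns to the derivative at a fixed parameter,
where the integration by parts takes place. -/
lemma fderiv_slice {F : P × E → ℝ} (hF : ContDiff ℝ 1 F) (v : P) (x e : E) :
    fderiv ℝ (fun y => F (v, y)) x e = fderiv ℝ F (v, x) (0, e) := by
  have h := ((hF.differentiable one_ne_zero (v, x)).hasFDerivAt).comp x
    (hasFDerivAt_prodMk_right v x)
  have h' : fderiv ℝ (fun y => F (v, y)) x = _ := h.fderiv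
  rw [h']
  simp

/-- Products and derivatives do not enlarge supports. Hence `G` need only invert the derivative of
the phase on the support of the original amplitude, and the same `G` serves at every iteration. -/
lemma tsupport_ibpAmplitude_subset {e : P → E} {G a : P × E → ℝ} (he : ContDiff ℝ (⊤ : ℕ∞) e)
    (hG : ContDiff ℝ (⊤ : ℕ∞) G) (ha : ContDiff ℝ (⊤ : ℕ∞) a) (v : P) (k : ℕ) :
    tsupport (fun x => ibpAmplitude e G a k (v, x)) ⊆ tsupport (fun x => a (v, x)) := by
  induction k with
  | zero => exact subset_rfl
  | succ k ih =>
    have h1 : (fun x => ibpAmplitude e G a (k + 1) (v, x)) =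
        fun x => fderiv ℝ (fun y => ibpAmplitude e G a k (v, y) * G (v, y)) x (e v) := by
      funext x
      exact (fderiv_slice (F := fun z => ibpAmplitude e G a k z * G z)
        (((contDiff_ibpAmplitude he hG ha k).mul hG).of_le (by exact_mod_cast le_top)) v x _).symm
    rw [h1]
    refine (tsupport_fderiv_apply_subset ℝ (e v)).trans (subset_trans ?_ ih)
    exact tsupport_mul_subset_left

end IteratedAmplitude

section NonStationary

variable {E : Type*} [NormedAddCommGroup E] [NormedSpace ℝ E] [FiniteDimensional ℝ E]
  [MeasurableSpace E] [BorelSpace E] (μ : Measure E) [μ.IsAddHaarMeasure]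

/-- Integration by parts in the direction `e` for an oscillatory integral. -/
lemma integral_cexp_mul_eq_integral_fderiv {ψ b γ : E → ℝ} {e : E}
    (hψ : ContDiff ℝ 1 ψ) (hb : ContDiff ℝ 1 b) (hγ : ContDiff ℝ 1 γ)
    (hbs : HasCompactSupport b) (hd : ∀ x ∈ tsupport b, fderiv ℝ ψ x e * γ x = 1)
    {lam : ℝ} (hlam : lam ≠ 0) :
    ∫ x, Complex.exp ((lam * ψ x : ℝ) * Complex.I) * (b x : ℂ) ∂μ =
      (Complex.I / lam) * ∫ x, Complex.exp ((lam * ψ x : ℝ) * Complex.I) *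
        ((fderiv ℝ (fun y => b y * γ y) x e : ℝ) : ℂ) ∂μ := by
  set u : E → ℂ := fun x => Complex.exp ((lam * ψ x : ℝ) * Complex.I) with hu
  set v : E → ℂ := fun x => ((b x * γ x : ℝ) : ℂ) with hv
  have huC : ContDiff ℝ 1 u :=
    ((Complex.ofRealCLM.contDiff.comp (contDiff_const.mul hψ)).mul contDiff_const).cexp
  have hbγ : ContDiff ℝ 1 (fun y => b y * γ y) := hb.mul hγ
  have hvC : ContDiff ℝ 1 v := Complex.ofRealCLM.contDiff.comp hbγ
  have hvs : HasCompactSupport v := by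
    refine (hbs.mul_right (f' := γ)).comp_left (g := fun r : ℝ => (r : ℂ)) (by simp)
  have hu' : ∀ x, fderiv ℝ u x e = (lam * fderiv ℝ ψ x e : ℝ) * Complex.I * u x := by
    intro x
    have h1 : HasFDerivAt (fun x => lam * ψ x) (lam • fderiv ℝ ψ x) x :=
      ((hψ.differentiable one_ne_zero x).hasFDerivAt).const_mul lam
    have h2 := ((Complex.ofRealCLM.hasFDerivAt.comp x h1).mul_const Complex.I).cexp
    have h3 : fderiv ℝ u x = _ := h2.fderiv
    rw [h3]
    simp [hu]
    ring
  have hv' : ∀ x, fderiv ℝ v x e = ((fderiv ℝ (fun y => b y * γ y) x e : ℝ) : ℂ) := by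
    intro x
    have h1 := Complex.ofRealCLM.hasFDerivAt.comp x
      ((hbγ.differentiable one_ne_zero x).hasFDerivAt)
    have h3 : fderiv ℝ v x = _ := h1.fderiv
    rw [h3]
    simp
  have huc' : Continuous fun x => fderiv ℝ u x e :=
    (huC.continuous_fderiv one_ne_zero).clm_apply continuous_const
  have hvc' : Continuous fun x => fderiv ℝ v x e :=
    (hvC.continuous_fderiv one_ne_zero).clm_apply continuous_const
  have hvs' : HasCompactSupport fun x => fderiv ℝ v x e := hvs.fderiv_apply ℝ e
  have key := integral_mul_fderiv_eq_neg_fderiv_mul_of_integrable (𝕜 := ℂ) (μ := μ) (f := u)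
    (g := v) (v := e)
    ((huc'.mul hvC.continuous).integrable_of_hasCompactSupport hvs.mul_left)
    ((huC.continuous.mul hvc').integrable_of_hasCompactSupport hvs'.mul_left)
    ((huC.continuous.mul hvC.continuous).integrable_of_hasCompactSupport hvs.mul_left)
    (fun x _ => huC.differentiable one_ne_zero x) (fun x _ => hvC.differentiable one_ne_zero x)
  simp only [← hv']
  rw [key, ← integral_neg, ← integral_const_mul]
  refine integral_congr_ae (Filter.Eventually.of_forall fun x => ?_)
  by_cases hx : b x = 0
  · simp [hv, hx]
  · have h1 := hd x (subset_tsupport _ hx)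
    have h2 : ((fderiv ℝ ψ x e : ℝ) : ℂ) * (γ x : ℂ) = 1 := by exact_mod_cast h1
    have hl : (lam : ℂ) ≠ 0 := by exact_mod_cast hlam
    change u x * _ = _ * -(_ * _)
    simp only [hu', hv]
    push_cast
    rw [div_mul_eq_mul_div, eq_div_iff hl]
    linear_combination (u x * b x * lam * Complex.I ^ 2) * h2 + u x * b x * lam * Complex.I_sq

variable {P : Type*} [NormedAddCommGroup P] [NormedSpace ℝ P]

/-- Non-stationary phase with parameters: rapid decay, uniform over a compact set of parameters. -/
lemma exists_norm_integral_cexp_le {e : P → E} {Ψ G a : P × E → ℝ}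
    (he : ContDiff ℝ (⊤ : ℕ∞) e) (hΨ : ContDiff ℝ (⊤ : ℕ∞) Ψ)
    (hG : ContDiff ℝ (⊤ : ℕ∞) G) (ha : ContDiff ℝ (⊤ : ℕ∞) a)
    {K : Set P} (hK : IsCompact K) {S : Set E} (hS : IsCompact S)
    (haS : ∀ v, tsupport (fun x => a (v, x)) ⊆ S) (N : ℕ) :
    ∃ M : ℝ, 0 ≤ M ∧ ∀ v ∈ K,
      (∀ x ∈ tsupport (fun x => a (v, x)),
        fderiv ℝ (fun y => Ψ (v, y)) x (e v) * G (v, x) = 1) →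
      ∀ lam : ℝ, lam ≠ 0 →
        |lam| ^ N * ‖∫ x, Complex.exp ((lam * Ψ (v, x) : ℝ) * Complex.I) * (a (v, x) : ℂ) ∂μ‖
          ≤ M := by
  obtain ⟨B, hB⟩ := (hK.prod hS).exists_bound_of_continuousOn
    (contDiff_ibpAmplitude he hG ha N).continuous.continuousOn
  refine ⟨|B| * μ.real S, by positivity, fun v hv hd lam hlam => ?_⟩
  have hsl : ∀ {F : P × E → ℝ}, ContDiff ℝ (⊤ : ℕ∞) F → ContDiff ℝ 1 (fun x => F (v, x)) :=
    fun hF => (hF.comp (contDiff_const.prodMk contDiff_id)).of_le (by exact_mod_cast le_top)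
  -- Each integration by parts gains a factor `1 / |lam|` and replaces the amplitude by the next
  -- one; the bound then follows from the supremum of the `N`-th amplitude and the volume of `S`.
  have key : ∀ k : ℕ, |lam| ^ k *
      ‖∫ x, Complex.exp ((lam * Ψ (v, x) : ℝ) * Complex.I) * (a (v, x) : ℂ) ∂μ‖ =
      ‖∫ x, Complex.exp ((lam * Ψ (v, x) : ℝ) * Complex.I) *
        (ibpAmplitude e G a k (v, x) : ℂ) ∂μ‖ := by
    intro k
    induction k with
    | zero => simp [ibpAmplitude]
    | succ k ih =>
      have hsub := tsupport_ibpAmplitude_subset he hG ha v k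
      have h1 := integral_cexp_mul_eq_integral_fderiv μ (e := e v) (hsl hΨ)
        (hsl (contDiff_ibpAmplitude he hG ha k)) (hsl hG)
        (hS.of_isClosed_subset (isClosed_tsupport _) (hsub.trans (haS v)))
        (fun x hx => hd x (hsub hx)) hlam
      have h2 : ∀ x, fderiv ℝ (fun y => ibpAmplitude e G a k (v, y) * G (v, y)) x (e v) =
          ibpAmplitude e G a (k + 1) (v, x) := fun x =>
        fderiv_slice (F := fun z => ibpAmplitude e G a k z * G z)
          (((contDiff_ibpAmplitude he hG ha k).mul hG).of_le (by exact_mod_cast le_top)) v x _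
      simp only [h2] at h1
      rw [pow_succ, mul_right_comm, ih, h1, norm_mul, norm_div, Complex.norm_I, Complex.norm_real,
        Real.norm_eq_abs, mul_right_comm, one_div_mul_cancel (abs_ne_zero.mpr hlam), one_mul]
  rw [key N]
  have hzero : ∀ x ∉ S, Complex.exp ((lam * Ψ (v, x) : ℝ) * Complex.I) *
        (ibpAmplitude e G a N (v, x) : ℂ) = 0 := by
    intro x hx
    have : ibpAmplitude e G a N (v, x) = 0 := by
      refine image_eq_zero_of_notMem_tsupport
        (f := fun x => ibpAmplitude e G a N (v, x)) fun h => hx ?_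
      exact haS v (tsupport_ibpAmplitude_subset he hG ha v N h)
    simp [this]
  rw [← setIntegral_eq_integral_of_forall_compl_eq_zero hzero]
  refine norm_setIntegral_le_of_norm_le_const hS.measure_lt_top fun x hx => ?_
  rw [norm_mul, Complex.norm_exp_ofReal_mul_I, one_mul, Complex.norm_real]
  exact (hB (v, x) ⟨hv, hx⟩).trans (le_abs_self B)

end NonStationary

/-! ### The phase of the fourth order equation -/

/-- A smooth function that coincides with the reciprocal on `[c, ∞)`. -/
def smoothRecip (c x : ℝ) : ℝ := Real.smoothTransition (2 * x / c - 1) * x⁻¹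

lemma contDiff_smoothRecip {c : ℝ} (hc : 0 < c) : ContDiff ℝ (⊤ : ℕ∞) (smoothRecip c) := by
  rw [contDiff_iff_contDiffAt]
  intro x
  rcases eq_or_ne x 0 with rfl | hx
  · have : smoothRecip c =ᶠ[nhds 0] fun _ => 0 := by
      filter_upwards [Iio_mem_nhds (show (0 : ℝ) < c / 2 by positivity)] with x hx
      have hx' : x < c / 2 := hx
      have : 2 * x / c - 1 ≤ 0 := by
        rw [sub_nonpos, div_le_one hc]; linarith
      simp [smoothRecip, Real.smoothTransition.zero_of_nonpos this]
    exact contDiffAt_const.congr_of_eventuallyEq this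
  · have h1 : ContDiff ℝ (⊤ : ℕ∞) fun x : ℝ => Real.smoothTransition (2 * x / c - 1) :=
      Real.smoothTransition.contDiff.comp
        (((contDiff_const.mul contDiff_id).div_const c).sub contDiff_const)
    exact h1.contDiffAt.mul (contDiffAt_inv ℝ hx)

lemma smoothRecip_eq_inv {c x : ℝ} (hc : 0 < c) (hx : c ≤ x) : smoothRecip c x = x⁻¹ := by
  have : 1 ≤ 2 * x / c - 1 := by
    rw [le_sub_iff_add_le, le_div_iff₀ hc]; linarith
  simp [smoothRecip, Real.smoothTransition.one_of_one_le this]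

section Phase

variable {n : ℕ}

/-- The difference quotient of `|η|⁴ + ε|η|²` at `η` in the unit direction `e` with step `ρ`,
as a function of `((e, ρ, ε), η)`. -/
def quarticQuotient (w : (Rn n × ℝ × ℝ) × Rn n) : ℝ :=
  (2 * inner ℝ w.2 w.1.1 + w.1.2.1) *
    (2 * ‖w.2‖ ^ 2 + 2 * w.1.2.1 * inner ℝ w.2 w.1.1 + w.1.2.1 ^ 2 + w.1.2.2)

/-- The derivative of `quarticQuotient` in the direction `e`. -/
def quarticQuotientDeriv (w : (Rn n × ℝ × ℝ) × Rn n) : ℝ :=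
  2 * (2 * ‖w.2‖ ^ 2 + 2 * w.1.2.1 * inner ℝ w.2 w.1.1 + w.1.2.1 ^ 2 + w.1.2.2) +
    2 * (2 * inner ℝ w.2 w.1.1 + w.1.2.1) ^ 2

lemma contDiff_quarticQuotient :
    ContDiff ℝ (⊤ : ℕ∞) (quarticQuotient : (Rn n × ℝ × ℝ) × Rn n → ℝ) := by
  have h1 : ContDiff ℝ (⊤ : ℕ∞) fun w : (Rn n × ℝ × ℝ) × Rn n => inner ℝ w.2 w.1.1 :=
    contDiff_snd.inner ℝ contDiff_fst.fst
  have h2 : ContDiff ℝ (⊤ : ℕ∞) fun w : (Rn n × ℝ × ℝ) × Rn n => ‖w.2‖ ^ 2 :=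
    contDiff_snd.norm_sq ℝ
  unfold quarticQuotient
  fun_prop

lemma contDiff_quarticQuotientDeriv :
    ContDiff ℝ (⊤ : ℕ∞) (quarticQuotientDeriv : (Rn n × ℝ × ℝ) × Rn n → ℝ) := by
  have h1 : ContDiff ℝ (⊤ : ℕ∞) fun w : (Rn n × ℝ × ℝ) × Rn n => inner ℝ w.2 w.1.1 :=
    contDiff_snd.inner ℝ contDiff_fst.fst
  have h2 : ContDiff ℝ (⊤ : ℕ∞) fun w : (Rn n × ℝ × ℝ) × Rn n => ‖w.2‖ ^ 2 :=
    contDiff_snd.norm_sq ℝ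
  unfold quarticQuotientDeriv
  fun_prop

lemma fderiv_quarticQuotient {e : Rn n} (he : ‖e‖ = 1) (ρ ε : ℝ) (η : Rn n) :
    fderiv ℝ (fun y => quarticQuotient ((e, ρ, ε), y)) η e = quarticQuotientDeriv ((e, ρ, ε), η) := by
  have hd : DifferentiableAt ℝ (fun y => quarticQuotient ((e, ρ, ε), y)) η :=
    ((contDiff_quarticQuotient.comp (contDiff_const.prodMk contDiff_id)).differentiable
      (by simp)) η
  rw [← hd.lineDeriv_eq_fderiv, lineDeriv]
  have hfun : (fun t : ℝ => quarticQuotient ((e, ρ, ε), η + t • e)) = fun t : ℝ =>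
      (2 * (inner ℝ η e + t) + ρ) *
        (2 * (‖η‖ ^ 2 + 2 * t * inner ℝ η e + t ^ 2) + 2 * ρ * (inner ℝ η e + t) + ρ ^ 2 + ε) := by
    funext t
    simp only [quarticQuotient]
    rw [norm_add_sq_real, inner_add_left, inner_smul_left, real_inner_self_eq_norm_sq, he,
      inner_smul_right, norm_smul, he]
    simp only [Real.norm_eq_abs, mul_one, sq_abs, conj_trivial, one_pow]
    ring
  rw [hfun]
  set v := inner ℝ η e
  have h1 : HasDerivAt (fun t : ℝ => 2 * (v + t) + ρ) 2 0 := by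
    simpa using (((hasDerivAt_id (0 : ℝ)).const_add v).const_mul 2).add_const ρ
  have h2 : HasDerivAt (fun t : ℝ => 2 * (‖η‖ ^ 2 + 2 * t * v + t ^ 2) + 2 * ρ * (v + t) + ρ ^ 2 + ε)
      (2 * (2 * v) + 2 * ρ) 0 := by
    have h3 : HasDerivAt (fun t : ℝ => ‖η‖ ^ 2 + 2 * t * v + t ^ 2) (2 * v) 0 := by
      have := ((((hasDerivAt_id (0 : ℝ)).const_mul 2).mul_const v).const_add (‖η‖ ^ 2)).fun_add
        (hasDerivAt_pow 2 (0 : ℝ))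
      simpa using this
    have h4 : HasDerivAt (fun t : ℝ => 2 * ρ * (v + t)) (2 * ρ) 0 := by
      simpa using ((hasDerivAt_id (0 : ℝ)).const_add v).const_mul (2 * ρ)
    exact (((h3.const_mul 2).fun_add h4).add_const _).add_const _
  rw [(h1.fun_mul h2).deriv]
  simp only [quarticQuotientDeriv]
  change _ = 2 * (2 * ‖η‖ ^ 2 + 2 * ρ * v + ρ ^ 2 + ε) + 2 * (2 * v + ρ) ^ 2
  ring

/-- The derivative equals `2(‖η‖² + ‖η + ρe‖² + ε) + 2(2⟨η, e⟩ + ρ)²`; two nonnegative terms are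
dropped. This lower bound is what rules out stationary points. -/
lemma le_quarticQuotientDeriv {e : Rn n} (he : ‖e‖ = 1) (ρ ε : ℝ) (η : Rn n) :
    2 * (‖η‖ ^ 2 + ε) ≤ quarticQuotientDeriv ((e, ρ, ε), η) := by
  have h : ‖η + ρ • e‖ ^ 2 = ‖η‖ ^ 2 + 2 * ρ * inner ℝ η e + ρ ^ 2 := by
    rw [norm_add_sq_real, inner_smul_right, norm_smul, he]
    simp only [Real.norm_eq_abs, mul_one, sq_abs]
    ring
  simp only [quarticQuotientDeriv]
  nlinarith [sq_nonneg ‖η + ρ • e‖, sq_nonneg (2 * inner ℝ η e + ρ)]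

/-- The difference of the squared norms is `ρ(2⟨η, e⟩ + ρ)`, and it divides the difference of the
fourth powers. The quotient by `ρ` is therefore a polynomial, smooth up to `ρ = 0`, so the
parameters range over a compact set. -/
lemma quartic_sub_eq {e : Rn n} (he : ‖e‖ = 1) (ρ ε : ℝ) (η : Rn n) :
    (‖η + ρ • e‖ ^ 4 + ε * ‖η + ρ • e‖ ^ 2) - (‖η‖ ^ 4 + ε * ‖η‖ ^ 2) =
      ρ * quarticQuotient ((e, ρ, ε), η) := by
  have h : ‖η + ρ • e‖ ^ 2 = ‖η‖ ^ 2 + 2 * ρ * inner ℝ η e + ρ ^ 2 := by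
    rw [norm_add_sq_real, inner_smul_right, norm_smul, he]
    simp only [Real.norm_eq_abs, mul_one, sq_abs]
    ring
  have h4 : ‖η + ρ • e‖ ^ 4 = (‖η + ρ • e‖ ^ 2) ^ 2 := by ring
  rw [h4, h]
  simp only [quarticQuotient]
  ring

/-- The autocorrelation of the oscillating amplitude decays rapidly, uniformly in `ε`. -/
lemma exists_norm_integral_quarticQuotient_le {χ : Rn n → ℝ} (hχ : ContDiff ℝ (⊤ : ℕ∞) χ)
    (hχs : HasCompactSupport χ) {c : ℝ} (hc : 0 < c) (R : ℝ) (N : ℕ) :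
    ∃ M : ℝ, 0 ≤ M ∧ ∀ (e : Rn n) (ρ ε : ℝ), ‖e‖ = 1 → ρ ∈ Set.Icc 0 R → ε ∈ Set.Icc (0 : ℝ) 1 →
      (∀ η, χ η ≠ 0 → c ≤ ‖η‖ ^ 2 + ε) → ∀ lam : ℝ, lam ≠ 0 →
      |lam| ^ N * ‖∫ η, Complex.exp ((lam * quarticQuotient ((e, ρ, ε), η) : ℝ) * Complex.I) *
        ((χ (η + ρ • e) * χ η : ℝ) : ℂ)‖ ≤ M := by
  have haS : ∀ v : Rn n × ℝ × ℝ,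
      tsupport (fun η => χ (η + v.2.1 • v.1) * χ η) ⊆ tsupport χ :=
    fun v => tsupport_mul_subset_right
  have ha : ContDiff ℝ (⊤ : ℕ∞) fun w : (Rn n × ℝ × ℝ) × Rn n =>
      χ (w.2 + w.1.2.1 • w.1.1) * χ w.2 := by
    refine (hχ.comp ?_).mul (hχ.comp contDiff_snd)
    fun_prop
  -- The cutoff threshold `2c` is the lower bound of the derivative on the support; there `G` is the
  -- true reciprocal, while it stays smooth elsewhere.
  have hG : ContDiff ℝ (⊤ : ℕ∞) fun w : (Rn n × ℝ × ℝ) × Rn n =>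
      smoothRecip (2 * c) (quarticQuotientDeriv w) :=
    (contDiff_smoothRecip (by positivity)).comp contDiff_quarticQuotientDeriv
  obtain ⟨M, hM0, hM⟩ := exists_norm_integral_cexp_le (volume : Measure (Rn n))
    (e := fun v : Rn n × ℝ × ℝ => v.1) contDiff_fst contDiff_quarticQuotient hG ha
    (K := Metric.sphere (0 : Rn n) 1 ×ˢ (Set.Icc 0 R ×ˢ Set.Icc (0 : ℝ) 1))
    ((isCompact_sphere _ _).prod (isCompact_Icc.prod isCompact_Icc)) hχs haS N
  refine ⟨M, hM0, fun e ρ ε he hρ hε hχc lam hlam => ?_⟩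
  refine hM (e, ρ, ε) ⟨by simpa using he, hρ, hε⟩ (fun η hη => ?_) lam hlam
  -- The lower bound is a closed condition, so it passes from `{χ ≠ 0}` to the topological support.
  have hcη : c ≤ ‖η‖ ^ 2 + ε := by
    have hcl : IsClosed {η : Rn n | c ≤ ‖η‖ ^ 2 + ε} :=
      isClosed_le continuous_const (by fun_prop)
    exact closure_minimal (fun x hx => hχc x hx) hcl (haS _ hη)
  have hD : 2 * c ≤ quarticQuotientDeriv ((e, ρ, ε), η) :=
    le_trans (by linarith) (le_quarticQuotientDeriv he ρ ε η)
  rw [fderiv_quarticQuotient he, smoothRecip_eq_inv (by positivity) hD, mul_inv_cancel₀]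
  exact (lt_of_lt_of_le (by positivity) hD).ne'

end Phase

/-! ### Dispersive estimate by autocorrelation -/

section Dispersive

variable {n : ℕ}

/-- The squared modulus of an integral is the integral of the autocorrelation. -/
lemma integral_mul_conj_integral_eq {E : Type*} [NormedAddCommGroup E] [MeasurableSpace E]
    [BorelSpace E] [SecondCountableTopology E] {μ : Measure E} [SigmaFinite μ]
    [μ.IsAddLeftInvariant] {f : E → ℂ} (hf : Integrable f μ) :
    (∫ x, f x ∂μ) * starRingEnd ℂ (∫ x, f x ∂μ) =
      ∫ h, ∫ x, f (x + h) * starRingEnd ℂ (f x) ∂μ ∂μ := by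
  have hconj : Integrable (fun x => starRingEnd ℂ (f x)) μ :=
    (Complex.conjCLE.toContinuousLinearMap).integrable_comp hf
  have h1 : Integrable (fun z : E × E => starRingEnd ℂ (f z.1) * f z.2) (μ.prod μ) :=
    hconj.mul_prod hf
  have h2 : Integrable (fun z : E × E => f (z.1 + z.2) * starRingEnd ℂ (f z.1)) (μ.prod μ) := by
    have := (measurePreserving_prod_add μ μ).integrable_comp_of_integrable h1
    simpa [Function.comp_def, mul_comm] using this
  rw [integral_integral_swap (f := fun h x => f (x + h) * starRingEnd ℂ (f x)) h2.swap,
    ← integral_conj, ← integral_const_mul]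
  refine integral_congr_ae (Filter.Eventually.of_forall fun x => ?_)
  simp only
  rw [integral_mul_const, integral_add_left_eq_self f x]

/-- Dispersive estimate for the phase `|η|⁴ + ε|η|²`, uniform in `ε ∈ [0, 1]`. -/
theorem exists_norm_sq_integral_quartic_le (hn : 1 ≤ n) {χ : Rn n → ℝ}
    (hχ : ContDiff ℝ (⊤ : ℕ∞) χ) (hχs : HasCompactSupport χ) {c : ℝ} (hc : 0 < c) :
    ∃ C : ℝ, 0 ≤ C ∧ ∀ ε ∈ Set.Icc (0 : ℝ) 1, (∀ η, χ η ≠ 0 → c ≤ ‖η‖ ^ 2 + ε) →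
      ∀ (τ : ℝ) (y : Rn n), τ ≠ 0 →
      ‖∫ η, Complex.exp ((inner ℝ y η + τ * (‖η‖ ^ 4 + ε * ‖η‖ ^ 2) : ℝ) * Complex.I) *
        (χ η : ℂ)‖ ^ 2 ≤ C * (|τ| ^ n)⁻¹ := by
  have : NeZero n := ⟨by omega⟩
  obtain ⟨R, hR⟩ := hχs.isCompact.isBounded.subset_closedBall (0 : Rn n)
  have hχR : ∀ η, χ η ≠ 0 → ‖η‖ ≤ R := fun η h => by
    simpa using hR (subset_tsupport _ h)
  -- The orders `0` and `n + 1` together give decay `(1 + |λ|)^{-(n+1)}`, just enough for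
  -- integrability on `ℝⁿ`. Steps longer than `2R` do not occur, since both factors of the
  -- autocorrelation live in the ball of radius `R`.
  obtain ⟨M₀, hM₀, hb₀⟩ := exists_norm_integral_quarticQuotient_le hχ hχs hc (2 * R) 0
  obtain ⟨M₁, hM₁, hb₁⟩ := exists_norm_integral_quarticQuotient_le hχ hχs hc (2 * R) (n + 1)
  set J : ℝ := ∫ h : Rn n, (1 + ‖h‖) ^ (-((n : ℝ) + 1)) with hJ
  have hJ0 : 0 ≤ J := integral_nonneg fun h => by positivity
  have hJi : Integrable fun h : Rn n => (1 + ‖h‖) ^ (-((n : ℝ) + 1)) :=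
    integrable_one_add_norm (by simp)
  refine ⟨2 ^ n * (M₀ + M₁) * J, by positivity, fun ε hε hχc τ y hτ => ?_⟩
  set f : Rn n → ℂ := fun η =>
    Complex.exp ((inner ℝ y η + τ * (‖η‖ ^ 4 + ε * ‖η‖ ^ 2) : ℝ) * Complex.I) * (χ η : ℂ) with hf
  have hfc : Continuous f := by
    have := hχ.continuous
    simp only [hf]
    fun_prop
  have hfi : Integrable f := by
    refine hfc.integrable_of_hasCompactSupport ?_
    exact (hχs.comp_left (g := fun r : ℝ => (r : ℂ)) (by simp)).mul_left
  have hsq : ‖∫ η, f η‖ ^ 2 = ‖∫ h, ∫ x, f (x + h) * starRingEnd ℂ (f x)‖ := by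
    rw [← integral_mul_conj_integral_eq hfi, norm_mul, RCLike.norm_conj, sq]
  rw [hsq]
  have hinner : ∀ h : Rn n, h ≠ 0 → ‖∫ x, f (x + h) * starRingEnd ℂ (f x)‖ ≤
      2 ^ n * (M₀ + M₁) * (1 + ‖τ • h‖) ^ (-((n : ℝ) + 1)) := by
    intro h hh
    have hρ : 0 < ‖h‖ := norm_pos_iff.mpr hh
    set e : Rn n := ‖h‖⁻¹ • h with he
    have he1 : ‖e‖ = 1 := by rw [he, norm_smul, norm_inv, norm_norm, inv_mul_cancel₀ hρ.ne']
    have hhe : ‖h‖ • e = h := by rw [he, smul_smul, mul_inv_cancel₀ hρ.ne', one_smul]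
    by_cases hR2 : ‖h‖ ≤ 2 * R
    · have hlam : τ * ‖h‖ ≠ 0 := mul_ne_zero hτ hρ.ne'
      set X := ‖∫ η, Complex.exp (((τ * ‖h‖) * quarticQuotient ((e, ‖h‖, ε), η) : ℝ) * Complex.I) *
        ((χ (η + ‖h‖ • e) * χ η : ℝ) : ℂ)‖ with hX
      -- The linear phase contributes only the constant `e^{i⟨y, h⟩}`, of modulus one, whence
      -- uniformity in `y`.
      have hXeq : ‖∫ x, f (x + h) * starRingEnd ℂ (f x)‖ = X := by
        have : ∀ x, f (x + h) * starRingEnd ℂ (f x) =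
            Complex.exp ((inner ℝ y h : ℝ) * Complex.I) *
            (Complex.exp (((τ * ‖h‖) * quarticQuotient ((e, ‖h‖, ε), x) : ℝ) * Complex.I) *
              ((χ (x + ‖h‖ • e) * χ x : ℝ) : ℂ)) := by
          intro x
          have hq := quartic_sub_eq he1 ‖h‖ ε x
          rw [mul_assoc τ, ← hq, hhe]
          simp only [hf, map_mul, ← Complex.exp_conj, Complex.conj_ofReal, Complex.conj_I]
          rw [mul_mul_mul_comm, ← Complex.exp_add, ← mul_assoc (Complex.exp _) (Complex.exp _),
            ← Complex.exp_add, inner_add_right]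
          congr 1
          · congr 1
            push_cast
            ring
          · push_cast; ring
        simp only [this, integral_const_mul, norm_mul, Complex.norm_exp_ofReal_mul_I, one_mul, hX]
      have hX0 : X ≤ M₀ := by
        simpa only [pow_zero, one_mul] using hb₀ e ‖h‖ ε he1 ⟨hρ.le, hR2⟩ hε hχc _ hlam
      have hX1 : |τ * ‖h‖| ^ (n + 1) * X ≤ M₁ := hb₁ e ‖h‖ ε he1 ⟨hρ.le, hR2⟩ hε hχc _ hlam
      have hnorm : ‖τ • h‖ = |τ * ‖h‖| := by rw [norm_smul, abs_mul, abs_norm, Real.norm_eq_abs]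
      rw [hXeq, hnorm, Real.rpow_neg (by positivity), ← div_eq_mul_inv, le_div_iff₀ (by positivity)]
      have hpow : (1 + |τ * ‖h‖|) ^ ((n : ℝ) + 1) = (1 + |τ * ‖h‖|) ^ (n + 1) := by
        exact_mod_cast Real.rpow_natCast _ (n + 1)
      rw [hpow]
      -- Convexity, `(1 + x)^{n+1} ≤ 2ⁿ(1 + x^{n+1})`, is the source of the factor `2ⁿ` in the
      -- constant.
      have hle := add_pow_le (zero_le_one' ℝ) (abs_nonneg (τ * ‖h‖)) (n + 1)
      simp only [one_pow, Nat.add_sub_cancel] at hle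
      calc X * (1 + |τ * ‖h‖|) ^ (n + 1) ≤ X * (2 ^ n * (1 + |τ * ‖h‖| ^ (n + 1))) := by
            gcongr
        _ = 2 ^ n * (X + |τ * ‖h‖| ^ (n + 1) * X) := by ring
        _ ≤ 2 ^ n * (M₀ + M₁) := by gcongr
    · have : ∀ x, f (x + h) * starRingEnd ℂ (f x) = 0 := by
        intro x
        by_cases h1 : χ x = 0
        · simp [hf, h1]
        by_cases h2 : χ (x + h) = 0
        · simp [hf, h2]
        exfalso
        apply hR2
        calc ‖h‖ = ‖(x + h) - x‖ := by simp
          _ ≤ ‖x + h‖ + ‖x‖ := norm_sub_le _ _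
          _ ≤ 2 * R := by linarith [hχR _ h1, hχR _ h2]
      simp only [this, integral_zero, norm_zero]
      positivity
  have hint : Integrable fun h : Rn n =>
      2 ^ n * (M₀ + M₁) * (1 + ‖τ • h‖) ^ (-((n : ℝ) + 1)) :=
    (hJi.comp_smul hτ).const_mul _
  refine (norm_integral_le_of_norm_le hint ?_).trans ?_
  -- The shift `h = 0` has no direction, but it is a null set because `n ≥ 1`.
  · filter_upwards [Measure.ae_ne volume (0 : Rn n)] with h hh using hinner h hh
  · rw [integral_const_mul, Measure.integral_comp_smul volume
      (fun h : Rn n => (1 + ‖h‖) ^ (-((n : ℝ) + 1))) τ, ← hJ]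
    simp only [finrank_euclideanSpace, Fintype.card_fin, smul_eq_mul, abs_inv, abs_pow]
    apply le_of_eq
    ring

end Dispersive

/-! ### Complex interpolation between dual exponents -/

section Interpolation

/-- The complex number with the argument of `a` and modulus `‖a‖ ^ w`, for complex `w`. -/
def polarPow (a w : ℂ) : ℂ := if a = 0 then 0 else (‖a‖ : ℂ) ^ w * (a / ‖a‖)

lemma norm_polarPow (a : ℂ) {w : ℂ} (hw : 0 < w.re) : ‖polarPow a w‖ = ‖a‖ ^ w.re := by
  unfold polarPow
  split_ifs with h
  · simp [h, Real.zero_rpow hw.ne']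
  · have h' : 0 < ‖a‖ := norm_pos_iff.mpr h
    rw [norm_mul, Complex.norm_cpow_eq_rpow_re_of_pos h', norm_div, Complex.norm_real, norm_norm,
      div_self h'.ne', mul_one]

lemma polarPow_one (a : ℂ) : polarPow a 1 = a := by
  unfold polarPow
  split_ifs with h
  · exact h.symm
  · rw [Complex.cpow_one, mul_div_cancel₀]
    exact_mod_cast norm_ne_zero_iff.mpr h

/-- Only the modulus is raised to a complex power, with the phase of `a` kept fixed, so the value is
entire in the exponent. -/
lemma differentiable_polarPow (a : ℂ) : Differentiable ℂ (polarPow a) := by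
  unfold polarPow
  split_ifs with h
  · exact differentiable_const _
  · have h' : (‖a‖ : ℂ) ≠ 0 := by exact_mod_cast norm_ne_zero_iff.mpr h
    exact fun w => ((differentiableAt_id).const_cpow (Or.inl h')).mul_const _

lemma norm_polarPow_le (a : ℂ) {w : ℂ} {m : ℝ} (hw : 0 < w.re) (hm : w.re ≤ m) :
    ‖polarPow a w‖ ≤ (1 + ‖a‖) ^ m := by
  rw [norm_polarPow a hw]
  calc ‖a‖ ^ w.re ≤ (1 + ‖a‖) ^ w.re :=
        Real.rpow_le_rpow (norm_nonneg _) (by linarith) hw.le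
    _ ≤ (1 + ‖a‖) ^ m := Real.rpow_le_rpow_of_exponent_le (by linarith [norm_nonneg a]) hm

/-- Riesz-Thorin interpolation between `ℓ² × ℓ²` and `ℓ¹ × ℓ¹` bounds for a bilinear form. -/
theorem norm_bilin_sum_le_interp {ι κ : Type*} (s : Finset ι) (t : Finset κ) (c : ι → κ → ℂ)
    {α : ι → ℝ} {β : κ → ℝ} (hα : ∀ i, 0 ≤ α i) (hβ : ∀ j, 0 ≤ β j) {A B : ℝ}
    (hA : 0 ≤ A) (hB : 0 ≤ B)
    (h2 : ∀ (u : ι → ℂ) (v : κ → ℂ), ‖∑ i ∈ s, ∑ j ∈ t, u i * v j * c i j‖ ≤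
      A * (∑ i ∈ s, ‖u i‖ ^ (2 : ℝ) * α i) ^ (1 / 2 : ℝ) *
        (∑ j ∈ t, ‖v j‖ ^ (2 : ℝ) * β j) ^ (1 / 2 : ℝ))
    (h1 : ∀ (u : ι → ℂ) (v : κ → ℂ), ‖∑ i ∈ s, ∑ j ∈ t, u i * v j * c i j‖ ≤
      B * (∑ i ∈ s, ‖u i‖ * α i) * (∑ j ∈ t, ‖v j‖ * β j))
    {r : ℝ} (hr1 : 1 ≤ r) (hr2 : r ≤ 2) (u : ι → ℂ) (v : κ → ℂ) :
    ‖∑ i ∈ s, ∑ j ∈ t, u i * v j * c i j‖ ≤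
      A ^ (2 - 2 / r) * B ^ (2 / r - 1) * (∑ i ∈ s, ‖u i‖ ^ r * α i) ^ (1 / r) *
        (∑ j ∈ t, ‖v j‖ ^ r * β j) ^ (1 / r) := by
  have hr0 : 0 < r := by linarith
  -- The affine exponent has real part `r / 2` on `Re z = 0` and `r` on `Re z = 1`, turning `ℓʳ`
  -- data into `ℓ²` and `ℓ¹` data. It equals `1` at `z = 2 / r - 1`, where `F` is the original form.
  set w : ℂ → ℂ := fun z => (r / 2 : ℝ) * (1 + z) with hw
  have hwre : ∀ z, (w z).re = r / 2 * (1 + z.re) := fun z => by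
    simp only [hw, Complex.re_ofReal_mul, Complex.add_re, Complex.one_re]
  set F : ℂ → ℂ := fun z =>
    ∑ i ∈ s, ∑ j ∈ t, polarPow (u i) (w z) * polarPow (v j) (w z) * c i j with hF
  have hwd : Differentiable ℂ w := by
    simp only [hw]; fun_prop
  have hFd : Differentiable ℂ F := by
    refine Differentiable.fun_sum fun i _ => Differentiable.fun_sum fun j _ => ?_
    exact (((differentiable_polarPow _).comp hwd).mul
      ((differentiable_polarPow _).comp hwd)).mul_const _
  set U := ∑ i ∈ s, ‖u i‖ ^ r * α i with hU
  set V := ∑ j ∈ t, ‖v j‖ ^ r * β j with hV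
  have hU0 : 0 ≤ U := Finset.sum_nonneg fun i _ => by have := hα i; positivity
  have hV0 : 0 ≤ V := Finset.sum_nonneg fun i _ => by have := hβ i; positivity
  have hbdd : BddAbove ((norm ∘ F) '' Complex.HadamardThreeLines.verticalClosedStrip 0 1) := by
    refine ⟨∑ i ∈ s, ∑ j ∈ t, (1 + ‖u i‖) ^ r * (1 + ‖v j‖) ^ r * ‖c i j‖, ?_⟩
    rintro _ ⟨z, hz, rfl⟩
    have hz' : z.re ∈ Set.Icc (0 : ℝ) 1 := hz
    have hz0 : 0 < (w z).re := by rw [hwre]; nlinarith [hz'.1]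
    have hz1 : (w z).re ≤ r := by rw [hwre]; nlinarith [hz'.2]
    refine (norm_sum_le _ _).trans (Finset.sum_le_sum fun i _ =>
      (norm_sum_le _ _).trans (Finset.sum_le_sum fun j _ => ?_))
    rw [norm_mul, norm_mul]
    gcongr <;> exact norm_polarPow_le _ hz0 hz1
  have ha : ∀ z ∈ Complex.re ⁻¹' {(0 : ℝ)}, ‖F z‖ ≤ A * U ^ (1 / 2 : ℝ) * V ^ (1 / 2 : ℝ) := by
    intro z hz
    have hz' : z.re = 0 := hz
    have hre : (w z).re = r / 2 := by rw [hwre, hz']; ring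
    have hn : ∀ a : ℂ, ‖polarPow a (w z)‖ ^ (2 : ℝ) = ‖a‖ ^ r := fun a => by
      rw [norm_polarPow a (by rw [hre]; positivity), hre, ← Real.rpow_mul (norm_nonneg _)]
      congr 1; ring
    simpa only [hn] using h2 (fun i => polarPow (u i) (w z)) (fun j => polarPow (v j) (w z))
  have hb : ∀ z ∈ Complex.re ⁻¹' {(1 : ℝ)}, ‖F z‖ ≤ B * U * V := by
    intro z hz
    have hz' : z.re = 1 := hz
    have hre : (w z).re = r := by rw [hwre, hz']; ring
    have hn : ∀ a : ℂ, ‖polarPow a (w z)‖ = ‖a‖ ^ r := fun a => by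
      rw [norm_polarPow a (by rw [hre]; positivity), hre]
    simpa only [hn] using h1 (fun i => polarPow (u i) (w z)) (fun j => polarPow (v j) (w z))
  set θ : ℝ := 2 / r - 1 with hθ
  have hθ0 : 0 ≤ θ := by rw [hθ, sub_nonneg, le_div_iff₀ hr0]; linarith
  have hθ1 : θ ≤ 1 := by
    have : 2 / r ≤ 2 := by rw [div_le_iff₀ hr0]; linarith
    rw [hθ]; linarith
  have key := Complex.HadamardThreeLines.norm_le_interp_of_mem_verticalClosedStrip₀₁' F
    (z := (θ : ℂ)) ⟨by simpa using hθ0, by simpa using hθ1⟩ hFd.diffContOnCl hbdd ha hb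
  have hwθ : w θ = 1 := by
    simp only [hw, hθ]
    have : (r : ℂ) ≠ 0 := by exact_mod_cast hr0.ne'
    push_cast
    field_simp
    ring
  have hFθ : F θ = ∑ i ∈ s, ∑ j ∈ t, u i * v j * c i j := by
    simp only [hF, hwθ, polarPow_one]
  rw [hFθ, Complex.ofReal_re] at key
  refine key.trans (le_of_eq ?_)
  have hexp : ∀ {x : ℝ}, 0 ≤ x → (x ^ (1 / 2 : ℝ)) ^ (1 - θ) * x ^ θ = x ^ (1 / r) := by
    intro x hx
    rw [← Real.rpow_mul hx, ← Real.rpow_add_of_nonneg hx (by nlinarith) hθ0]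
    congr 1
    rw [hθ]; field_simp; ring
  rw [Real.mul_rpow (by positivity) (by positivity), Real.mul_rpow hA (by positivity),
    Real.mul_rpow (by positivity) hV0, Real.mul_rpow hB hU0, ← hexp hU0, ← hexp hV0,
    show 2 - 2 / r = 1 - θ by rw [hθ]; ring]
  ring

end Interpolation

/-! ### Hölder's inequality and its converse -/

section Duality

variable {X : Type*} [MeasurableSpace X] {μ : Measure X}

/-- Hölder's inequality for the integral of a product. -/
lemma enorm_integral_mul_le {p r : ℝ≥0∞} [p.HolderConjugate r] {f g : X → ℂ}
    (hf : AEStronglyMeasurable f μ) (hg : AEStronglyMeasurable g μ) :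
    ‖∫ x, f x * g x ∂μ‖ₑ ≤ eLpNorm f p μ * eLpNorm g r μ :=
  calc ‖∫ x, f x * g x ∂μ‖ₑ ≤ ∫⁻ x, ‖f x * g x‖ₑ ∂μ := enorm_integral_le_lintegral_enorm _
    _ = eLpNorm (f • g) 1 μ := by rw [eLpNorm_one_eq_lintegral_enorm]; rfl
    _ ≤ _ := eLpNorm_smul_le_mul_eLpNorm hg hf

/-- The `Lᵖ` norm is controlled by pairings with simple functions in the dual space. -/
lemma eLpNorm_le_of_forall_simpleFunc {p r : ℝ} (hpr : p.HolderConjugate r) {h : X → ℂ}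
    (hh : MemLp h (ENNReal.ofReal p) μ) {L : ℝ≥0∞} (hL : L ≠ ∞)
    (H : ∀ g : SimpleFunc X ℂ, MemLp g (ENNReal.ofReal r) μ →
      ‖∫ x, h x * g x ∂μ‖ₑ ≤ L * eLpNorm g (ENNReal.ofReal r) μ) :
    eLpNorm h (ENNReal.ofReal p) μ ≤ L := by
  have hp0 : 0 < p := hpr.pos
  have hr0 : 0 < r := hpr.symm.pos
  have hpt : 0 < p - 1 := hpr.sub_one_pos
  have : (ENNReal.ofReal p).HolderConjugate (ENNReal.ofReal r) := hpr.ennrealOfReal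
  have : Fact (1 ≤ ENNReal.ofReal r) := ⟨ENNReal.HolderConjugate.one_le _ (ENNReal.ofReal p)⟩
  -- Simple functions are dense in `Lʳ`, and the error is controlled by Hölder because `h` is
  -- already known to lie in `Lᵖ`.
  have Hext : ∀ g : X → ℂ, MemLp g (ENNReal.ofReal r) μ →
      ‖∫ x, h x * g x ∂μ‖ₑ ≤ L * eLpNorm g (ENNReal.ofReal r) μ := by
    intro g hg
    set N := eLpNorm h (ENNReal.ofReal p) μ
    have hN : N ≠ ∞ := hh.eLpNorm_ne_top
    have hclose : ∀ ε : ℝ≥0∞, ε ≠ 0 → ‖∫ x, h x * g x ∂μ‖ₑ ≤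
        L * (eLpNorm g (ENNReal.ofReal r) μ + ε) + N * ε := by
      intro ε hε
      obtain ⟨s, hs, hsm⟩ := hg.exists_simpleFunc_eLpNorm_sub_lt ENNReal.ofReal_ne_top hε
      have hsplit : ∫ x, h x * g x ∂μ = ∫ x, h x * s x ∂μ + ∫ x, h x * (g - s) x ∂μ := by
        rw [← integral_add]
        · simp only [Pi.sub_apply]; congr 1; funext x; ring
        · exact hh.integrable_mul hsm
        · exact hh.integrable_mul (hg.sub hsm)
      have hsle : eLpNorm s (ENNReal.ofReal r) μ ≤ eLpNorm g (ENNReal.ofReal r) μ + ε := by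
        have : (s : X → ℂ) = g - (g - s) := by simp
        rw [this]
        exact (eLpNorm_sub_le hg.1 (hg.1.sub hsm.1) Fact.out).trans (by gcongr)
      rw [hsplit]
      refine (enorm_add_le _ _).trans (add_le_add ((H s hsm).trans (by gcongr)) ?_)
      exact (enorm_integral_mul_le hh.1 (hg.1.sub hsm.1)).trans (by gcongr)
    have hlim : Filter.Tendsto (fun ε : ℝ≥0∞ => L * (eLpNorm g (ENNReal.ofReal r) μ + ε) + N * ε)
        (nhdsWithin 0 (Set.Ioi 0)) (nhds (L * (eLpNorm g (ENNReal.ofReal r) μ + 0) + N * 0)) := by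
      have h0 : Filter.Tendsto (fun ε : ℝ≥0∞ => ε) (nhdsWithin 0 (Set.Ioi 0)) (nhds 0) :=
        Filter.tendsto_id.mono_left nhdsWithin_le_nhds
      refine Filter.Tendsto.add (ENNReal.Tendsto.const_mul (tendsto_const_nhds.add h0) (Or.inr hL))
        (ENNReal.Tendsto.const_mul h0 (Or.inr hN))
    have := ge_of_tendsto hlim (by
      filter_upwards [self_mem_nhdsWithin] with ε hε using hclose ε (ne_of_gt hε))
    simpa using this
  -- The extremal function for Hölder: `h g = |h|ᵖ`, and the `Lʳ` norm of `g` is the `(p - 1)`-th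
  -- power of the `Lᵖ` norm of `h`, which cancels at the end.
  set g : X → ℂ := fun x => starRingEnd ℂ (h x) * ((‖h x‖ ^ (p - 2) : ℝ) : ℂ) with hg
  have hgn : ∀ x, ‖g x‖ = ‖h x‖ ^ (p - 1) := by
    intro x
    simp only [hg, norm_mul, RCLike.norm_conj, Complex.norm_real, Real.norm_eq_abs]
    rw [abs_of_nonneg (by positivity)]
    rcases eq_or_ne (h x) 0 with h0 | h0
    · simp [h0, Real.zero_rpow hpt.ne']
    · have h0' : 0 < ‖h x‖ := norm_pos_iff.mpr h0
      rw [← Real.rpow_one_add' h0'.le (by ring_nf; linarith)]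
      congr 1; ring
  have hgm : AEStronglyMeasurable g μ := by
    have h1 := hh.1.norm.aemeasurable.pow_const (p - 2)
    exact (Complex.continuous_conj.comp_aestronglyMeasurable hh.1).mul
      (Complex.measurable_ofReal.comp_aemeasurable h1).aestronglyMeasurable
  have hgr : eLpNorm g (ENNReal.ofReal r) μ = eLpNorm h (ENNReal.ofReal p) μ ^ (p - 1) := by
    have h1 : eLpNorm g (ENNReal.ofReal r) μ =
        eLpNorm (fun x => ‖h x‖ ^ (p - 1)) (ENNReal.ofReal r) μ := by
      refine eLpNorm_congr_norm_ae (Filter.Eventually.of_forall fun x => ?_)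
      rw [hgn, Real.norm_eq_abs, abs_of_nonneg (by positivity)]
    rw [h1, eLpNorm_norm_rpow _ hpt, ← ENNReal.ofReal_mul hr0.le]
    congr 2
    rw [mul_comm, hpr.sub_one_mul_conj]
  have hgL : MemLp g (ENNReal.ofReal r) μ := by
    refine ⟨hgm, ?_⟩
    rw [hgr]
    exact ENNReal.rpow_lt_top_of_nonneg hpt.le hh.eLpNorm_ne_top
  have hpair : ‖∫ x, h x * g x ∂μ‖ₑ = eLpNorm h (ENNReal.ofReal p) μ ^ p := by
    have h1 : ∀ x, h x * g x = ((‖h x‖ ^ p : ℝ) : ℂ) := by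
      intro x
      simp only [hg]
      rw [← mul_assoc, Complex.mul_conj, Complex.normSq_eq_norm_sq]
      rw [← Complex.ofReal_mul]
      congr 1
      rcases eq_or_ne (h x) 0 with h0 | h0
      · simp [h0, Real.zero_rpow hp0.ne']
      · have h0' : 0 < ‖h x‖ := norm_pos_iff.mpr h0
        rw [← Real.rpow_natCast, ← Real.rpow_add h0']
        congr 1; push_cast; ring
    simp only [h1]
    rw [integral_complex_ofReal, ← ofReal_norm, Complex.norm_real, Real.norm_eq_abs,
      abs_of_nonneg (integral_nonneg fun x => by positivity)]
    rw [ofReal_integral_eq_lintegral_ofReal _ (Filter.Eventually.of_forall fun x => by positivity)]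
    · rw [eLpNorm_eq_lintegral_rpow_enorm_toReal (by simpa using hp0) ENNReal.ofReal_ne_top,
        ENNReal.toReal_ofReal hp0.le, one_div, ENNReal.rpow_inv_rpow hp0.ne']
      refine lintegral_congr fun x => ?_
      rw [← ENNReal.ofReal_rpow_of_nonneg (norm_nonneg _) hp0.le, ofReal_norm]
    · have := hh.integrable_norm_rpow (by simpa using hp0) ENNReal.ofReal_ne_top
      rwa [ENNReal.toReal_ofReal hp0.le] at this
  have hfin := Hext g hgL
  rw [hpair, hgr] at hfin
  set N := eLpNorm h (ENNReal.ofReal p) μ with hN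
  rcases eq_or_ne N 0 with h0 | h0
  · rw [h0]; exact bot_le
  have hNt : N ≠ ∞ := hh.eLpNorm_ne_top
  have hsplit : N ^ p = N * N ^ (p - 1) := by
    conv_lhs => rw [show p = 1 + (p - 1) by ring, ENNReal.rpow_add _ _ h0 hNt, ENNReal.rpow_one]
  rw [hsplit] at hfin
  refine (ENNReal.mul_le_mul_iff_left ?_ ?_).mp hfin
  · exact (ENNReal.rpow_pos (pos_iff_ne_zero.mpr h0) hNt).ne'
  · exact ENNReal.rpow_ne_top_of_nonneg hpt.le hNt

end Duality

/-! ### Step functions and their norms -/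

section StepFunctions

variable {X ι : Type*}

/-- The step function with value `u i` on `A i` for `i ∈ s`. -/
def stepFn (s : Finset ι) (A : ι → Set X) (u : ι → ℂ) (x : X) : ℂ :=
  ∑ i ∈ s, (A i).indicator (fun _ => u i) x

lemma stronglyMeasurable_stepFn [MeasurableSpace X] {s : Finset ι} {A : ι → Set X} (hA : ∀ i, MeasurableSet (A i))
    (u : ι → ℂ) : StronglyMeasurable (stepFn s A u) := by
  unfold stepFn
  exact Finset.stronglyMeasurable_fun_sum _ fun i _ => stronglyMeasurable_const.indicator (hA i)

lemma enorm_stepFn_rpow {s : Finset ι} {A : ι → Set X} (hd : Pairwise fun i j => Disjoint (A i) (A j))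
    (u : ι → ℂ) {r : ℝ} (hr : 0 < r) (x : X) :
    ‖stepFn s A u x‖ₑ ^ r = ∑ i ∈ s, (A i).indicator (fun _ => ‖u i‖ₑ ^ r) x := by
  classical
  unfold stepFn
  by_cases h : ∃ i ∈ s, x ∈ A i
  · obtain ⟨i, hi, hx⟩ := h
    have hne : ∀ j ∈ s, j ≠ i → x ∉ A j := fun j _ hj hxj =>
      Set.disjoint_left.mp (hd hj) hxj hx
    rw [Finset.sum_eq_single_of_mem i hi fun j hj hji => Set.indicator_of_notMem (hne j hj hji) _,
      Finset.sum_eq_single_of_mem i hi fun j hj hji => Set.indicator_of_notMem (hne j hj hji) _,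
      Set.indicator_of_mem hx, Set.indicator_of_mem hx]
  · push Not at h
    rw [Finset.sum_eq_zero fun i hi => Set.indicator_of_notMem (h i hi) _,
      Finset.sum_eq_zero fun i hi => Set.indicator_of_notMem (h i hi) _]
    simp [hr]

variable [MeasurableSpace X] {μ : Measure X}

lemma eLpNorm_stepFn {s : Finset ι} {A : ι → Set X} (hA : ∀ i, MeasurableSet (A i))
    (hd : Pairwise fun i j => Disjoint (A i) (A j)) (hfin : ∀ i ∈ s, μ (A i) ≠ ∞)
    (u : ι → ℂ) {r : ℝ} (hr : 0 < r) :
    eLpNorm (stepFn s A u) (ENNReal.ofReal r) μ =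
      ENNReal.ofReal ((∑ i ∈ s, ‖u i‖ ^ r * μ.real (A i)) ^ (1 / r)) := by
  rw [eLpNorm_eq_lintegral_rpow_enorm_toReal (by simpa using hr) ENNReal.ofReal_ne_top,
    ENNReal.toReal_ofReal hr.le]
  simp only [enorm_stepFn_rpow hd u hr]
  rw [lintegral_finsetSum _ fun i _ => (measurable_const.indicator (hA i)),
    ← ENNReal.ofReal_rpow_of_nonneg (Finset.sum_nonneg fun i _ => by positivity) (by positivity),
    ENNReal.ofReal_sum_of_nonneg fun i _ => by positivity]
  congr 1
  refine Finset.sum_congr rfl fun i hi => ?_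
  rw [lintegral_indicator_const (hA i), ENNReal.ofReal_mul (by positivity),
    ← ENNReal.ofReal_rpow_of_nonneg (norm_nonneg _) hr.le, ofReal_norm, Measure.real,
    ENNReal.ofReal_toReal (hfin i hi)]

lemma memLp_stepFn {s : Finset ι} {A : ι → Set X} (hA : ∀ i, MeasurableSet (A i))
    (hd : Pairwise fun i j => Disjoint (A i) (A j)) (hfin : ∀ i ∈ s, μ (A i) ≠ ∞)
    (u : ι → ℂ) {r : ℝ} (hr : 0 < r) : MemLp (stepFn s A u) (ENNReal.ofReal r) μ := by
  refine ⟨(stronglyMeasurable_stepFn hA u).aestronglyMeasurable, ?_⟩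
  rw [eLpNorm_stepFn hA hd hfin u hr]
  exact ENNReal.ofReal_lt_top

/-- The value `0` is left out of the index set because its fibre may have infinite measure. -/
lemma SimpleFunc.eq_stepFn (f : SimpleFunc X ℂ) :
    (f : X → ℂ) = stepFn (f.range.filter (· ≠ 0)) (fun a => f ⁻¹' {a}) id := by
  classical
  funext x
  unfold stepFn
  rw [Finset.sum_filter_of_ne]
  · rw [Finset.sum_eq_single_of_mem (f x) (SimpleFunc.mem_range_self f x)]
    · simp
    · intro b _ hb
      exact Set.indicator_of_notMem (by simpa using hb.symm) _
  · intro a _ ha h0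
    apply ha
    simp [h0]

end StepFunctions

/-! ### Convolution operators and interpolation of their bilinear forms -/

section ConvolutionOperator

variable {n : ℕ}

/-- Convolution with the kernel `κ`. -/
def convOp (κ f : Rn n → ℂ) (x : Rn n) : ℂ := ∫ y, κ (x - y) * f y

lemma enorm_convOp_le {p r : ℝ≥0∞} [p.HolderConjugate r] {κ f : Rn n → ℂ}
    (hκ : AEStronglyMeasurable κ) (hf : AEStronglyMeasurable f) (x : Rn n) :
    ‖convOp κ f x‖ₑ ≤ eLpNorm κ p * eLpNorm f r := by
  have hmp := Measure.measurePreserving_sub_left (volume : Measure (Rn n)) x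
  have h1 : eLpNorm (fun y => κ (x - y)) p volume = eLpNorm κ p := eLpNorm_comp_measurePreserving hκ hmp
  rw [← h1]
  exact enorm_integral_mul_le (hκ.comp_measurePreserving hmp) hf

lemma integrable_convOp_integrand {p r : ℝ≥0∞} [p.HolderConjugate r] {κ f : Rn n → ℂ}
    (hκ : MemLp κ p) (hf : MemLp f r) (x : Rn n) : Integrable fun y => κ (x - y) * f y :=
  (hκ.comp_measurePreserving (Measure.measurePreserving_sub_left volume x)).integrable_mul hf

lemma aestronglyMeasurable_convOp_integrand {κ f : Rn n → ℂ} (hκ : Continuous κ)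
    (hf : AEStronglyMeasurable f) :
    AEStronglyMeasurable (fun z : Rn n × Rn n => κ (z.1 - z.2) * f z.2) (volume.prod volume) :=
  (hκ.comp (continuous_fst.sub continuous_snd)).aestronglyMeasurable.mul hf.comp_snd

lemma aestronglyMeasurable_convOp {κ f : Rn n → ℂ} (hκ : Continuous κ)
    (hf : AEStronglyMeasurable f) : AEStronglyMeasurable (convOp κ f) :=
  (aestronglyMeasurable_convOp_integrand hκ hf).integral_prod_right'

lemma convOp_sub {p r : ℝ≥0∞} [p.HolderConjugate r] {κ f g : Rn n → ℂ}
    (hκ : MemLp κ p) (hf : MemLp f r) (hg : MemLp g r) (x : Rn n) :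
    convOp κ (f - g) x = convOp κ f x - convOp κ g x := by
  unfold convOp
  rw [← integral_sub (integrable_convOp_integrand hκ hf x) (integrable_convOp_integrand hκ hg x)]
  simp only [Pi.sub_apply, mul_sub]

variable {κ : 𝓢(Rn n, ℂ)} {B : ℝ≥0}

lemma eLpNorm_convOp_top_le (hB : ∀ x, ‖κ x‖ ≤ B) {f : Rn n → ℂ}
    (hf : AEStronglyMeasurable f) : eLpNorm (convOp κ f) ∞ ≤ B * eLpNorm f 1 := by
  rw [eLpNorm_exponent_top]
  refine eLpNormEssSup_le_of_ae_enorm_bound (Filter.Eventually.of_forall fun x => ?_)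
  have : (∞ : ℝ≥0∞).HolderConjugate 1 := ENNReal.HolderConjugate.symm
  refine (enorm_convOp_le (p := ∞) (r := 1) κ.continuous.aestronglyMeasurable hf x).trans ?_
  gcongr
  rw [eLpNorm_exponent_top]
  refine eLpNormEssSup_le_of_ae_enorm_bound (Filter.Eventually.of_forall fun x => ?_)
  rw [← ofReal_norm]
  exact ENNReal.ofReal_le_of_le_toReal (by simpa using hB x)

/-- The pairing of step functions through a convolution operator, as a bilinear form in the
values. -/
lemma integral_convOp_stepFn_mul_stepFn {ι ι' : Type*} {s : Finset ι} {t : Finset ι'}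
    {A : ι → Set (Rn n)} {A' : ι' → Set (Rn n)} (hA : ∀ i, MeasurableSet (A i))
    (hA' : ∀ j, MeasurableSet (A' j)) (hfin : ∀ i ∈ s, volume (A i) ≠ ∞)
    (hfin' : ∀ j ∈ t, volume (A' j) ≠ ∞) (u : ι → ℂ) (v : ι' → ℂ) :
    ∫ x, convOp κ (stepFn s A u) x * stepFn t A' v x =
      ∑ i ∈ s, ∑ j ∈ t, u i * v j * ∫ x in A' j, ∫ y in A i, κ (x - y) := by
  have h1 : ∀ x, convOp κ (stepFn s A u) x = ∑ i ∈ s, u i * ∫ y in A i, κ (x - y) := by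
    intro x
    unfold convOp stepFn
    simp only [Finset.mul_sum]
    rw [integral_finsetSum]
    · refine Finset.sum_congr rfl fun i _ => ?_
      rw [← integral_indicator (hA i), ← integral_const_mul]
      congr 1; funext y
      by_cases hy : y ∈ A i <;> simp [hy, mul_comm]
    · intro i hi
      have := integrable_convOp_integrand (p := ∞) (r := 1) (κ.memLp_top volume)
        (memLp_indicator_const 1 (hA i) (u i) (Or.inr (hfin i hi))) x
      exact this
  have hbdd : ∀ i ∈ s, ∀ x, ‖∫ y in A i, κ (x - y)‖ ≤
      SchwartzMap.seminorm ℝ 0 0 κ * volume.real (A i) := fun i hi x =>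
    norm_setIntegral_le_of_norm_le_const (lt_top_iff_ne_top.mpr (hfin i hi))
      fun y _ => κ.norm_le_seminorm ℝ _
  have hmeas : ∀ i, AEStronglyMeasurable fun x => ∫ y in A i, κ (x - y) := fun i =>
    AEStronglyMeasurable.integral_prod_right' (f := fun z : Rn n × Rn n => κ (z.1 - z.2))
      (κ.continuous.comp (continuous_fst.sub continuous_snd)).aestronglyMeasurable
  have hint : ∀ i ∈ s, ∀ j ∈ t, IntegrableOn (fun x => ∫ y in A i, κ (x - y)) (A' j) :=
    fun i hi j hj => by
      have : IsFiniteMeasure (volume.restrict (A' j)) :=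
        ⟨by simpa using lt_top_iff_ne_top.mpr (hfin' j hj)⟩
      exact Integrable.of_bound (hmeas i).restrict _ (Filter.Eventually.of_forall (hbdd i hi))
  have h2 : ∀ x, convOp κ (stepFn s A u) x * stepFn t A' v x =
      ∑ i ∈ s, ∑ j ∈ t, (A' j).indicator (fun x => u i * v j * ∫ y in A i, κ (x - y)) x := by
    intro x
    rw [h1, stepFn, Finset.sum_mul_sum]
    refine Finset.sum_congr rfl fun i _ => Finset.sum_congr rfl fun j _ => ?_
    by_cases hx : x ∈ A' j
    · simp only [Set.indicator_of_mem hx]; ring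
    · simp only [Set.indicator_of_notMem hx, mul_zero]
  simp only [h2]
  have hint2 : ∀ i ∈ s, ∀ j ∈ t, Integrable
      ((A' j).indicator (fun x => u i * v j * ∫ y in A i, κ (x - y))) := fun i hi j hj =>
    (integrable_indicator_iff (hA' j)).mpr ((hint i hi j hj).const_mul _)
  rw [integral_finsetSum _ fun i hi => integrable_finsetSum _ fun j hj => hint2 i hi j hj]
  refine Finset.sum_congr rfl fun i hi => ?_
  rw [integral_finsetSum _ fun j hj => hint2 i hi j hj]
  refine Finset.sum_congr rfl fun j hj => ?_
  rw [integral_indicator (hA' j), integral_const_mul]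

/-- The bilinear estimate for simple functions, by complex interpolation. -/
lemma enorm_integral_convOp_mul_simpleFunc_le (hB : ∀ x, ‖κ x‖ ≤ B)
    (h2 : ∀ f : Rn n → ℂ, MemLp f 2 → eLpNorm (convOp κ f) 2 ≤ eLpNorm f 2)
    {r : ℝ} (hr1 : 1 ≤ r) (hr2 : r ≤ 2) {f g : SimpleFunc (Rn n) ℂ}
    (hf : MemLp f (ENNReal.ofReal r)) (hg : MemLp g (ENNReal.ofReal r)) :
    ‖∫ x, convOp κ f x * g x‖ₑ ≤
      (B : ℝ≥0∞) ^ (2 / r - 1) * eLpNorm f (ENNReal.ofReal r) * eLpNorm g (ENNReal.ofReal r) := by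
  classical
  have hr0 : 0 < r := by linarith
  have key : ∀ f : SimpleFunc (Rn n) ℂ, MemLp f (ENNReal.ofReal r) →
      (∀ a, MeasurableSet (f ⁻¹' {a})) ∧ (Pairwise fun a b => Disjoint (f ⁻¹' {a}) (f ⁻¹' {b})) ∧
      ∀ a ∈ f.range.filter (· ≠ 0), volume (f ⁻¹' {a}) ≠ ∞ := fun f hf =>
    ⟨fun a => f.measurableSet_fiber a,
      fun a b hab => Disjoint.preimage _ (by simpa using hab),
      fun a ha => (SimpleFunc.measure_preimage_lt_top_of_memLp (by simpa using hr0)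
        ENNReal.ofReal_ne_top f hf a (Finset.mem_filter.mp ha).2).ne⟩
  obtain ⟨mf, df, ff⟩ := key f hf
  obtain ⟨mg, dg, fg⟩ := key g hg
  rw [SimpleFunc.eq_stepFn f, SimpleFunc.eq_stepFn g]
  set s := f.range.filter (· ≠ 0)
  set t := g.range.filter (· ≠ 0)
  set A := fun a : ℂ => f ⁻¹' {a}
  set A' := fun a : ℂ => g ⁻¹' {a}
  have hform := fun u v => integral_convOp_stepFn_mul_stepFn (κ := κ) mf mg ff fg u v
  have e2 : (2 : ℝ≥0∞) = ENNReal.ofReal 2 := by simp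
  have e1 : (1 : ℝ≥0∞) = ENNReal.ofReal 1 := by simp
  -- The weights are the measures of the fibres, so the weighted sums are the norms of the step
  -- functions. The two endpoint bounds hold for arbitrary values on these fixed fibres.
  have hinterp := norm_bilin_sum_le_interp s t
    (fun a b => ∫ x in A' b, ∫ y in A a, κ (x - y))
    (α := fun a => volume.real (A a)) (β := fun b => volume.real (A' b))
    (fun _ => measureReal_nonneg) (fun _ => measureReal_nonneg) zero_le_one B.coe_nonneg ?_ ?_ hr1 hr2 id id
  · rw [hform, eLpNorm_stepFn mf df ff id hr0, eLpNorm_stepFn mg dg fg id hr0,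
      ← ofReal_norm, ← ENNReal.ofReal_coe_nnreal, ENNReal.ofReal_rpow_of_nonneg B.coe_nonneg,
      ← ENNReal.ofReal_mul (by positivity), ← ENNReal.ofReal_mul (by positivity)]
    · refine ENNReal.ofReal_le_ofReal (hinterp.trans_eq ?_)
      rw [Real.one_rpow, one_mul]
    · rw [sub_nonneg, le_div_iff₀ hr0]; linarith
  · intro u v
    rw [← hform, one_mul, ← ENNReal.ofReal_le_ofReal_iff (by positivity), ofReal_norm,
      ENNReal.ofReal_mul (by positivity)]
    have hmu := memLp_stepFn (μ := volume) mf df ff u zero_lt_two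
    refine (enorm_integral_mul_le (p := 2) (r := 2)
      (aestronglyMeasurable_convOp κ.continuous hmu.1)
      (stronglyMeasurable_stepFn mg v).aestronglyMeasurable).trans ?_
    rw [← eLpNorm_stepFn mf df ff u zero_lt_two, ← eLpNorm_stepFn mg dg fg v zero_lt_two, ← e2]
    rw [← e2] at hmu
    gcongr
    exact h2 _ hmu
  · intro u v
    have hs : ∀ (s : Finset ℂ) (u : ℂ → ℂ) (α : ℂ → ℝ), ∑ i ∈ s, ‖u i‖ * α i =
        (∑ i ∈ s, ‖u i‖ ^ (1 : ℝ) * α i) ^ (1 / 1 : ℝ) := by simp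
    rw [← hform, hs s, hs t, ← ENNReal.ofReal_le_ofReal_iff (by positivity), ofReal_norm,
      ENNReal.ofReal_mul (by positivity), ENNReal.ofReal_mul (by positivity)]
    have hmu := (stronglyMeasurable_stepFn (s := s) mf u).aestronglyMeasurable (μ := volume)
    have : (∞ : ℝ≥0∞).HolderConjugate 1 := ENNReal.HolderConjugate.symm
    refine (enorm_integral_mul_le (p := ∞) (r := 1)
      (aestronglyMeasurable_convOp κ.continuous hmu)
      (stronglyMeasurable_stepFn mg v).aestronglyMeasurable).trans ?_
    rw [← eLpNorm_stepFn mf df ff u zero_lt_one, ← eLpNorm_stepFn mg dg fg v zero_lt_one, ← e1,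
      ENNReal.ofReal_coe_nnreal]
    gcongr
    exact eLpNorm_convOp_top_le hB hmu

end ConvolutionOperator

/-- Almost everywhere `|h|ᵖ ≤ ‖h‖_∞^{p-2} |h|²`. This supplies the a priori membership in `Lᵖ` that
the duality argument needs. -/
lemma memLp_of_memLp_two_of_memLp_top {X : Type*} [MeasurableSpace X] {μ : Measure X} {h : X → ℂ}
    (h2 : MemLp h 2 μ) (ht : MemLp h ∞ μ) {p : ℝ} (hp : 2 ≤ p) :
    MemLp h (ENNReal.ofReal p) μ := by
  have hp0 : 0 < p := by linarith
  refine ⟨h2.1, ?_⟩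
  rw [eLpNorm_lt_top_iff_lintegral_rpow_enorm_lt_top (by simpa using hp0) ENNReal.ofReal_ne_top,
    ENNReal.toReal_ofReal hp0.le]
  have h2' := (eLpNorm_lt_top_iff_lintegral_rpow_enorm_lt_top two_ne_zero
    ENNReal.ofNat_ne_top).mp h2.2
  have hC : eLpNorm h ∞ μ ^ (p - 2) < ∞ := ENNReal.rpow_lt_top_of_nonneg (by linarith) ht.2.ne
  refine lt_of_le_of_lt ?_ (ENNReal.mul_lt_top hC h2')
  rw [← lintegral_const_mul' _ _ hC.ne]
  refine lintegral_mono_ae ?_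
  rw [eLpNorm_exponent_top]
  filter_upwards [ae_le_eLpNormEssSup (f := h) (μ := μ)] with x hx
  calc ‖h x‖ₑ ^ p = ‖h x‖ₑ ^ (p - 2) * ‖h x‖ₑ ^ (2 : ℝ) := by
        rw [← ENNReal.rpow_add_of_nonneg _ _ (by linarith) (by norm_num)]
        congr 1; ring
    _ ≤ _ := by
        rw [ENNReal.toReal_ofNat]
        gcongr

/-! ### From simple functions to `Lʳ → Lᵖ` bounds -/

section ConvolutionOperator

variable {n : ℕ} {κ : 𝓢(Rn n, ℂ)} {B : ℝ≥0}

lemma eLpNorm_convOp_simpleFunc_le (hB : ∀ x, ‖κ x‖ ≤ B)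
    (h2 : ∀ f : Rn n → ℂ, MemLp f 2 → eLpNorm (convOp κ f) 2 ≤ eLpNorm f 2)
    {p r : ℝ} (hpr : p.HolderConjugate r) (hp : 2 ≤ p) {f : SimpleFunc (Rn n) ℂ}
    (hf : MemLp f (ENNReal.ofReal r)) :
    eLpNorm (convOp κ f) (ENNReal.ofReal p) ≤
      (B : ℝ≥0∞) ^ (2 / r - 1) * eLpNorm f (ENNReal.ofReal r) := by
  have hr0 : 0 < r := hpr.symm.pos
  have hr1 : 1 ≤ r := hpr.symm.lt.le
  have hr2 : r ≤ 2 := by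
    have h1 := hpr.inv_add_inv_eq_one
    have h3 : p⁻¹ ≤ 2⁻¹ := inv_anti₀ two_pos hp
    exact (inv_le_inv₀ two_pos hr0).mp (by linarith)
  -- A simple function in `Lʳ` has support of finite measure, hence lies in `L¹` and `L²`, where the
  -- endpoint bounds apply.
  have hfi : Integrable f :=
    (SimpleFunc.memLp_iff_integrable (by simpa using hr0) ENNReal.ofReal_ne_top).mp hf
  have hf2 : MemLp f 2 := (SimpleFunc.memLp_iff_integrable two_ne_zero ENNReal.ofNat_ne_top).mpr hfi
  have hm := aestronglyMeasurable_convOp κ.continuous hf2.1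
  have hT2 : MemLp (convOp κ f) 2 := ⟨hm, (h2 f hf2).trans_lt hf2.2⟩
  have hTt : MemLp (convOp κ f) ∞ := ⟨hm, (eLpNorm_convOp_top_le hB hf2.1).trans_lt
    (ENNReal.mul_lt_top ENNReal.coe_lt_top (memLp_one_iff_integrable.mpr hfi).2)⟩
  have hθ : 0 ≤ 2 / r - 1 := by rw [sub_nonneg, le_div_iff₀ hr0]; linarith
  refine eLpNorm_le_of_forall_simpleFunc hpr (memLp_of_memLp_two_of_memLp_top hT2 hTt hp)
    (ENNReal.mul_ne_top (ENNReal.rpow_ne_top_of_nonneg hθ ENNReal.coe_ne_top) hf.2.ne)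
    fun g hg => ?_
  exact enorm_integral_convOp_mul_simpleFunc_le hB h2 hr1 hr2 hf hg

/-- `Lʳ → Lᵖ` bound for a convolution operator with bounded kernel that contracts `L²`. -/
theorem eLpNorm_convOp_le (hB : ∀ x, ‖κ x‖ ≤ B)
    (h2 : ∀ f : Rn n → ℂ, MemLp f 2 → eLpNorm (convOp κ f) 2 ≤ eLpNorm f 2)
    {p r : ℝ≥0∞} [hpr : p.HolderConjugate r] (hp : 2 ≤ p) {f : Rn n → ℂ} (hf : MemLp f r) :
    eLpNorm (convOp κ f) p ≤ (B : ℝ≥0∞) ^ (2 * deltaExp p) * eLpNorm f r := by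
  -- At `p = ∞` the conjugate exponent is `1` and `2δ = 1`, so the estimate is the endpoint bound
  -- itself.
  rcases eq_or_ne p ∞ with rfl | hpt
  · obtain rfl : r = 1 := (ENNReal.HolderConjugate.eq_top_iff_eq_one ∞ r).mp rfl
    simpa [deltaExp] using eLpNorm_convOp_top_le hB hf.1
  have hp1 : 1 < p := lt_of_lt_of_le (by norm_num) hp
  have hrt : r ≠ ∞ := by
    intro h
    exact hp1.ne' ((ENNReal.HolderConjugate.eq_top_iff_eq_one r p).mp h)
  have hR : p.toReal.HolderConjugate r.toReal :=
    ENNReal.HolderConjugate.toReal_of_ne_top hpt hrt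
  have hpR : 2 ≤ p.toReal := by
    simpa using ENNReal.toReal_mono hpt hp
  have hθ : 2 / r.toReal - 1 = 2 * deltaExp p := by
    have := hR.inv_add_inv_eq_one
    rw [deltaExp, ENNReal.toReal_inv, div_eq_mul_inv]
    linarith
  have hθ0 : 0 ≤ 2 * deltaExp p := by
    rw [deltaExp, ENNReal.toReal_inv]
    have : p.toReal⁻¹ ≤ 2⁻¹ := inv_anti₀ (by norm_num) hpR
    linarith
  have hM : (B : ℝ≥0∞) ^ (2 * deltaExp p) ≠ ∞ := ENNReal.rpow_ne_top_of_nonneg hθ0 ENNReal.coe_ne_top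
  have hr1 : 1 ≤ r := ENNReal.HolderConjugate.one_le r p
  have hδ : ∀ k : ℕ, ((k : ℝ≥0∞) + 1)⁻¹ ≠ 0 := fun k => by simp
  choose s hs hsm using fun k : ℕ => hf.exists_simpleFunc_eLpNorm_sub_lt hrt (hδ k)
  have hzero : Filter.Tendsto (fun k : ℕ => ((k : ℝ≥0∞) + 1)⁻¹) Filter.atTop (nhds 0) := by
    have := (Filter.tendsto_add_atTop_iff_nat 1).mpr ENNReal.tendsto_inv_nat_nhds_zero
    simpa using this
  have hκp : MemLp κ p := κ.memLp p volume
  have hlim : ∀ x, Filter.Tendsto (fun k => convOp κ (s k) x) Filter.atTop (nhds (convOp κ f x)) := by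
    intro x
    rw [tendsto_iff_edist_tendsto_0]
    have hup : Filter.Tendsto (fun k : ℕ => eLpNorm κ p volume * ((k : ℝ≥0∞) + 1)⁻¹)
        Filter.atTop (nhds 0) := by
      simpa using ENNReal.Tendsto.const_mul hzero (Or.inr hκp.2.ne)
    refine tendsto_of_tendsto_of_tendsto_of_le_of_le tendsto_const_nhds hup (fun _ => bot_le)
      fun k => ?_
    simp only
    rw [edist_comm, edist_eq_enorm_sub, ← convOp_sub (r := r) hκp hf (hsm k)]
    refine (enorm_convOp_le (p := p) (r := r) hκp.1 (hf.sub (hsm k)).1 x).trans ?_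
    gcongr
    exact (hs k).le
  -- The Schwartz kernel lies in `Lᵖ`, so approximation in `Lʳ` yields pointwise convergence of the
  -- convolutions. Fatou's lemma then transfers the bound without assuming that the limit is in
  -- `Lᵖ`.
  refine (Lp.eLpNorm_lim_le_liminf_eLpNorm
    (fun k => aestronglyMeasurable_convOp κ.continuous (hsm k).1) _
    (Filter.Eventually.of_forall hlim)).trans ?_
  have hbound : ∀ k, eLpNorm (convOp κ (s k)) p ≤
      (B : ℝ≥0∞) ^ (2 * deltaExp p) * (eLpNorm f r + ((k : ℝ≥0∞) + 1)⁻¹) := by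
    intro k
    have h1 := eLpNorm_convOp_simpleFunc_le hB h2 hR hpR (f := s k)
      (by rw [ENNReal.ofReal_toReal hrt]; exact hsm k)
    rw [ENNReal.ofReal_toReal hrt, ENNReal.ofReal_toReal hpt, hθ] at h1
    refine h1.trans ?_
    gcongr
    have h3 : (s k : Rn n → ℂ) = f - (f - s k) := by simp
    rw [h3]
    exact (eLpNorm_sub_le hf.1 (hf.sub (hsm k)).1 hr1).trans (by gcongr; exact (hs k).le)
  have hT : Filter.Tendsto (fun k : ℕ => (B : ℝ≥0∞) ^ (2 * deltaExp p) *
      (eLpNorm f r + ((k : ℝ≥0∞) + 1)⁻¹)) Filter.atTop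
      (nhds ((B : ℝ≥0∞) ^ (2 * deltaExp p) * (eLpNorm f r + 0))) :=
    ENNReal.Tendsto.const_mul (tendsto_const_nhds.add hzero) (Or.inr hM)
  rw [add_zero] at hT
  rw [← hT.liminf_eq]
  exact Filter.liminf_le_liminf (Filter.Eventually.of_forall hbound)

end ConvolutionOperator

/-! ### Fourier multipliers with Schwartz symbols as convolutions -/

section Multiplier

open FourierTransform

variable {n : ℕ}

/-- Multipliers act on distributions through this transposed operator on test functions. The formula
moves the inverse transform from `φ` onto the modulated symbol; the pairing `-innerₗ` makes
`VectorFourier.fourierIntegral` the inverse transform. -/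
lemma fourier_smul_fourierInv_eq_integral (m φ : 𝓢(Rn n, ℂ)) (y : Rn n) :
    𝓕 (SchwartzMap.smulLeftCLM ℂ m (𝓕⁻ φ)) y = ∫ x, (𝓕⁻ m : 𝓢(Rn n, ℂ)) (x - y) * φ x := by
  set b : Rn n → ℂ := fun ξ => Real.fourierChar (-inner ℝ ξ y) • m ξ with hb
  have hbi : Integrable b := by
    refine (m.integrable (μ := volume)).mono ?_ (Filter.Eventually.of_forall fun ξ => by simp [hb, Circle.norm_smul])
    have : Continuous b := by
      have := m.continuous
      have := Real.continuous_fourierChar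
      simp only [hb]
      fun_prop
    exact this.aestronglyMeasurable
  have hL : Continuous fun p : Rn n × Rn n => (-innerₗ (Rn n)) p.1 p.2 := by
    exact (continuous_inner (𝕜 := ℝ)).neg
  have h := VectorFourier.integral_fourierIntegral_smul_eq_flip (L := -innerₗ (Rn n))
    (μ := volume) (ν := volume) Real.continuous_fourierChar hL (φ.integrable (μ := volume)) hbi
  have h1 : 𝓕 (SchwartzMap.smulLeftCLM ℂ m (𝓕⁻ φ)) y =
      ∫ ξ, VectorFourier.fourierIntegral Real.fourierChar volume (-innerₗ (Rn n)) φ ξ • b ξ := by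
    rw [SchwartzMap.fourier_coe, Real.fourier_eq]
    congr 1; funext ξ
    rw [SchwartzMap.smulLeftCLM_apply_apply m.hasTemperateGrowth, SchwartzMap.fourierInv_coe]
    simp only [hb, smul_eq_mul, Circle.smul_def]
    rw [Real.fourierInv_eq]
    simp only [VectorFourier.fourierIntegral, LinearMap.neg_apply, innerₗ_apply_apply, neg_neg]
    ring
  rw [h1, h]
  congr 1; funext x
  rw [mul_comm, smul_eq_mul]
  congr 1
  rw [SchwartzMap.fourierInv_coe, Real.fourierInv_eq]
  simp only [VectorFourier.fourierIntegral, hb]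
  congr 1; funext ξ
  rw [smul_smul, ← AddChar.map_add_eq_mul]
  congr 2
  simp [inner_sub_right, real_inner_comm]
  ring

/-- A tempered distribution is represented by the function `f`. -/
def Represents (u : 𝓢'(Rn n, ℂ)) (f : Rn n → ℂ) : Prop :=
  ∀ g : 𝓢(Rn n, ℂ), u g = ∫ x, g x * f x

/-- A Fourier multiplier with a Schwartz symbol acts as a convolution. -/
lemma Represents.fourierMultiplierCLM {u : 𝓢'(Rn n, ℂ)} {f : Rn n → ℂ} {r : ℝ≥0∞}
    (hr : 1 ≤ r) (hf : MemLp f r) (hu : Represents u f) (m : 𝓢(Rn n, ℂ)) :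
    Represents (TemperedDistribution.fourierMultiplierCLM ℂ m u)
      (convOp (𝓕⁻ m : 𝓢(Rn n, ℂ)) f) := by
  intro g
  set κ : 𝓢(Rn n, ℂ) := 𝓕⁻ m
  have hp : ((1 - r⁻¹)⁻¹).HolderConjugate r := by
    have := ENNReal.HolderConjugate.inv_one_sub_inv' hr
    exact ENNReal.HolderConjugate.symm
  rw [TemperedDistribution.fourierMultiplierCLM_apply_apply, hu]
  simp only [fourier_smul_fourierInv_eq_integral]
  -- Fubini is justified because the integral over the second variable is at most `|g|` times a
  -- constant, by Hölder with `κ` in the conjugate space.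
  have hint : Integrable (fun z : Rn n × Rn n => g z.1 * (κ (z.1 - z.2) * f z.2))
      (volume.prod volume) := by
    have hm : AEStronglyMeasurable (fun z : Rn n × Rn n => g z.1 * (κ (z.1 - z.2) * f z.2))
        (volume.prod volume) :=
      (g.continuous.comp continuous_fst).aestronglyMeasurable.mul
        (aestronglyMeasurable_convOp_integrand κ.continuous hf.1)
    rw [integrable_prod_iff hm]
    have hκp : MemLp κ (1 - r⁻¹)⁻¹ := κ.memLp _ volume
    refine ⟨Filter.Eventually.of_forall fun x =>
      (integrable_convOp_integrand hκp hf x).const_mul (g x), ?_⟩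
    refine ((g.integrable (μ := volume)).norm.mul_const
      (eLpNorm κ (1 - r⁻¹)⁻¹ volume * eLpNorm f r volume).toReal).mono
      hm.norm.integral_prod_right' (Filter.Eventually.of_forall fun x => ?_)
    have hle := enorm_convOp_le (κ := fun z => ((‖κ z‖ : ℝ) : ℂ)) (f := fun z => ((‖f z‖ : ℝ) : ℂ))
      (p := (1 - r⁻¹)⁻¹) (r := r)
      (Complex.continuous_ofReal.comp κ.continuous.norm).aestronglyMeasurable
      (Complex.continuous_ofReal.comp_aestronglyMeasurable hf.1.norm) x
    have e1 : eLpNorm (fun z => ((‖κ z‖ : ℝ) : ℂ)) (1 - r⁻¹)⁻¹ volume =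
        eLpNorm κ (1 - r⁻¹)⁻¹ volume :=
      eLpNorm_congr_norm_ae (Filter.Eventually.of_forall fun z => by simp)
    have e2 : eLpNorm (fun z => ((‖f z‖ : ℝ) : ℂ)) r volume = eLpNorm f r volume :=
      eLpNorm_congr_norm_ae (Filter.Eventually.of_forall fun z => by simp)
    rw [e1, e2] at hle
    have hreal : convOp (fun z => ((‖κ z‖ : ℝ) : ℂ)) (fun z => ((‖f z‖ : ℝ) : ℂ)) x =
        ((∫ y, ‖κ (x - y)‖ * ‖f y‖ : ℝ) : ℂ) := by
      unfold convOp
      rw [← integral_complex_ofReal]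
      push_cast
      rfl
    have hfin : eLpNorm κ (1 - r⁻¹)⁻¹ volume * eLpNorm f r volume ≠ ∞ :=
      ENNReal.mul_ne_top hκp.2.ne hf.2.ne
    have hle2 := ENNReal.toReal_mono hfin hle
    rw [hreal, toReal_enorm, Complex.norm_real, Real.norm_eq_abs] at hle2
    simp only [norm_mul, integral_const_mul]
    gcongr
    rw [Real.norm_of_nonneg ENNReal.toReal_nonneg, Real.norm_eq_abs]
    exact hle2
  have hswap := integral_integral_swap (f := fun x y => g x * (κ (x - y) * f y)) hint
  have hL : ∀ x, g x * convOp κ f x = ∫ y, g x * (κ (x - y) * f y) := fun x => by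
    rw [integral_const_mul]; rfl
  simp only [hL]
  rw [hswap]
  congr 1; funext y
  rw [← integral_mul_const]
  congr 1; funext x
  ring

/-- Compactly supported smooth functions are Schwartz and determine a locally integrable function.
This identifies the convolution with the `L²` function given by Plancherel. -/
lemma Represents.ae_eq {u : 𝓢'(Rn n, ℂ)} {f f' : Rn n → ℂ} (hf : Represents u f)
    (hf' : Represents u f') (hl : LocallyIntegrable f) (hl' : LocallyIntegrable f') :
    f =ᵐ[volume] f' := by
  refine ae_eq_of_integral_contDiff_smul_eq hl hl' fun g hg hgs => ?_
  have hg₁ : HasCompactSupport (Complex.ofRealCLM ∘ g) := hgs.comp_left rfl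
  have hg₂ : ContDiff ℝ (⊤ : ℕ∞) (Complex.ofRealCLM ∘ g) := by fun_prop
  have h := (hf (hg₁.toSchwartzMap hg₂)).symm.trans (hf' (hg₁.toSchwartzMap hg₂))
  simpa using h

/-- A multiplier with symbol bounded by `1` contracts `L²`. -/
lemma eLpNorm_convOp_two_le {m : 𝓢(Rn n, ℂ)} (hm : ∀ ξ, ‖m ξ‖ ≤ 1) {f : Rn n → ℂ}
    (hf : MemLp f 2) :
    eLpNorm (convOp (𝓕⁻ m : 𝓢(Rn n, ℂ)) f) 2 ≤ eLpNorm f 2 := by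
  set κ : 𝓢(Rn n, ℂ) := 𝓕⁻ m
  set F : Lp ℂ 2 (volume : Measure (Rn n)) := hf.toLp f
  have hrF : Represents (Lp.toTemperedDistribution F) f := by
    intro g
    rw [Lp.toTemperedDistribution_apply]
    refine integral_congr_ae ?_
    filter_upwards [hf.coeFn_toLp] with x hx
    rw [hx, smul_eq_mul]
  have hrep := hrF.fourierMultiplierCLM one_le_two hf m
  have hmt : MemLp (m : Rn n → ℂ) ∞ := m.memLp_top volume
  -- The multiplier is realized inside `L²`, where Plancherel and `|m| ≤ 1` give the contraction.
  set H : Lp ℂ 2 (volume : Measure (Rn n)) := 𝓕⁻ ((hmt.toLp _) • (𝓕 F) : Lp ℂ 2 volume)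
  have hH : TemperedDistribution.fourierMultiplierCLM ℂ m (Lp.toTemperedDistribution F) =
      Lp.toTemperedDistribution H := by
    rw [TemperedDistribution.fourierMultiplierCLM_apply, Lp.fourier_toTemperedDistribution_eq,
      ← Lp.toTemperedDistribution_smul_eq (p := ∞) (q := 2) (r := 2) m.hasTemperateGrowth hmt,
      Lp.fourierInv_toTemperedDistribution_eq]
  have hrH : Represents (Lp.toTemperedDistribution H) H := by
    intro g
    rw [Lp.toTemperedDistribution_apply]
    rfl
  rw [hH] at hrep
  have hκ2 : MemLp κ 2 := κ.memLp 2 volume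
  have hT : MemLp (convOp κ f) ∞ := by
    refine ⟨aestronglyMeasurable_convOp κ.continuous hf.1, ?_⟩
    rw [eLpNorm_exponent_top]
    refine lt_of_le_of_lt (eLpNormEssSup_le_of_ae_enorm_bound (Filter.Eventually.of_forall fun x =>
      enorm_convOp_le (p := 2) (r := 2) hκ2.1 hf.1 x)) (ENNReal.mul_lt_top hκ2.2 hf.2)
  have hae := hrep.ae_eq hrH (hT.locallyIntegrable le_top) ((Lp.memLp H).locallyIntegrable one_le_two)
  rw [eLpNorm_congr_ae hae]
  have hnorm : ‖H‖ ≤ ‖F‖ := by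
    have h1 : ‖H‖ = ‖((hmt.toLp _) • (𝓕 F) : Lp ℂ 2 volume)‖ := by
      rw [← Lp.norm_fourier_eq H, fourier_fourierInv_eq]
    have h2 : ‖hmt.toLp (m : Rn n → ℂ)‖ ≤ 1 := by
      rw [Lp.norm_toLp]
      refine ENNReal.toReal_le_of_le_ofReal zero_le_one ?_
      rw [eLpNorm_exponent_top]
      refine eLpNormEssSup_le_of_ae_enorm_bound (Filter.Eventually.of_forall fun x => ?_)
      rw [← ofReal_norm]
      exact ENNReal.ofReal_le_ofReal (hm x)
    rw [h1]
    refine (Lp.norm_smul_le _ _).trans ?_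
    rw [Lp.norm_fourier_eq]
    exact mul_le_of_le_one_left (norm_nonneg _) h2
  rw [Lp.norm_def, Lp.norm_toLp] at hnorm
  exact (ENNReal.toReal_le_toReal (Lp.eLpNorm_ne_top H) hf.2.ne).mp hnorm

end Multiplier

/-! ### The kernel of one frequency block -/

section Block

open FourierTransform

variable {n : ℕ}

/-- The symbol of the propagator localized by `χ` to frequencies of size `2 ^ K`, in the
normalization of Mathlib's Fourier transform. -/
def blockSymbol (χ : Rn n → ℝ) (K : ℕ) (t : ℝ) (ξ : Rn n) : ℂ :=
  Complex.exp (((t * (‖(2 * Real.pi) • ξ‖ ^ 4 + ‖(2 * Real.pi) • ξ‖ ^ 2) : ℝ) : ℂ) * Complex.I) *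
    (χ ((2 : ℝ) ^ (-(K : ℤ)) • ((2 * Real.pi) • ξ)) : ℂ)

/-- The substitution `ξ = a η` with `2π a = 2^K` moves the cutoff to unit scale, with Jacobian `aⁿ`.
Factoring `2^{4K}` out of the phase leaves `ε = 2^{-2K}` in front of `|η|²`. -/
lemma fourierInv_blockSymbol (χ : Rn n → ℝ) (K : ℕ) (t : ℝ) (x : Rn n) :
    𝓕⁻ (blockSymbol χ K t) x = ((2 : ℝ) ^ K / (2 * Real.pi)) ^ n •
      ∫ η, Complex.exp ((inner ℝ ((2 : ℝ) ^ K • x) η +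
        t * 2 ^ (4 * K) * (‖η‖ ^ 4 + ((2 : ℝ) ^ (2 * K))⁻¹ * ‖η‖ ^ 2) : ℝ) * Complex.I) *
        (χ η : ℂ) := by
  set a : ℝ := 2 ^ K / (2 * Real.pi) with ha
  have hπ := Real.pi_pos
  have ha0 : 0 < a := by positivity
  rw [Real.fourierInv_eq]
  have h := Measure.integral_comp_smul (volume : Measure (Rn n))
    (fun ξ => Real.fourierChar (inner ℝ ξ x) • blockSymbol χ K t ξ) a
  rw [finrank_euclideanSpace, Fintype.card_fin, abs_of_pos (by positivity)] at h
  rw [← inv_smul_eq_iff₀ (pow_pos ha0 n).ne', ← h]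
  congr 1; funext η
  have h2K : (0 : ℝ) < 2 ^ K := by positivity
  have e1 : (2 * Real.pi) • a • η = (2 : ℝ) ^ K • η := by
    rw [smul_smul, ha]; congr 1; field_simp
  have e2 : (2 : ℝ) ^ (-(K : ℤ)) • (2 : ℝ) ^ K • η = η := by
    rw [smul_smul, zpow_neg, zpow_natCast, inv_mul_cancel₀ h2K.ne', one_smul]
  simp only [blockSymbol]
  rw [e1, e2, Circle.smul_def, smul_eq_mul, Real.fourierChar_apply, ← mul_assoc, ← Complex.exp_add,
    ← add_mul]
  congr 3
  rw [← Complex.ofReal_add]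
  congr 1
  rw [inner_smul_left, inner_smul_left, norm_smul, Real.norm_of_nonneg h2K.le, conj_trivial,
    conj_trivial, real_inner_comm η x, ha]
  have e4 : (2 : ℝ) ^ (4 * K) = ((2 : ℝ) ^ K) ^ 4 := by rw [← pow_mul, mul_comm]
  have e5 : (2 : ℝ) ^ (2 * K) = ((2 : ℝ) ^ K) ^ 2 := by rw [← pow_mul, mul_comm]
  rw [e4, e5]
  field_simp

/-- Uniform bounds for the convolution kernel of the localized propagator. -/
lemma exists_norm_fourierInv_blockSymbol_le (hn : 1 ≤ n) {χ : Rn n → ℝ}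
    (hχ : ContDiff ℝ (⊤ : ℕ∞) χ) (hχs : HasCompactSupport χ) :
    ∃ C : ℝ, 0 ≤ C ∧ ∀ (K : ℕ) (t : ℝ),
      (∀ η, χ η ≠ 0 → 1 / 16 ≤ ‖η‖ ^ 2 + ((2 : ℝ) ^ (2 * K))⁻¹) → ∀ x,
      ‖𝓕⁻ (blockSymbol χ K t) x‖ ≤ C * (2 : ℝ) ^ ((K : ℝ) * n) ∧
      (t ≠ 0 → ‖𝓕⁻ (blockSymbol χ K t) x‖ ≤
        C * ((2 : ℝ) ^ (-((K : ℝ) * n)) * |t| ^ (-((n : ℝ) / 2)))) := by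
  obtain ⟨C₁, hC₁, hb⟩ := exists_norm_sq_integral_quartic_le hn hχ hχs (c := 1 / 16) (by norm_num)
  set C₀ := ∫ η, ‖χ η‖ with hC₀
  have hC₀0 : 0 ≤ C₀ := integral_nonneg fun _ => norm_nonneg _
  refine ⟨max C₀ (Real.sqrt C₁), le_max_of_le_left hC₀0, fun K t hK x => ?_⟩
  rw [fourierInv_blockSymbol, norm_smul]
  set a : ℝ := 2 ^ K / (2 * Real.pi) with ha
  have hπ := Real.pi_gt_three
  have ha0 : 0 < a := by positivity
  have haK : a ≤ 2 ^ K := div_le_self (by positivity) (by linarith)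
  have han : ‖a ^ n‖ ≤ (2 : ℝ) ^ ((K : ℝ) * n) := by
    rw [Real.norm_of_nonneg (by positivity), Real.rpow_mul zero_le_two, Real.rpow_natCast,
      Real.rpow_natCast]
    gcongr
  set I := ∫ η, Complex.exp ((inner ℝ ((2 : ℝ) ^ K • x) η +
        t * 2 ^ (4 * K) * (‖η‖ ^ 4 + ((2 : ℝ) ^ (2 * K))⁻¹ * ‖η‖ ^ 2) : ℝ) * Complex.I) *
        (χ η : ℂ) with hI
  have hε : ((2 : ℝ) ^ (2 * K))⁻¹ ∈ Set.Icc (0 : ℝ) 1 :=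
    ⟨by positivity, inv_le_one_of_one_le₀ (one_le_pow₀ one_le_two)⟩
  constructor
  · have h0 : ‖I‖ ≤ C₀ := by
      refine (norm_integral_le_integral_norm _).trans_eq ?_
      congr 1; funext η
      rw [norm_mul, Complex.norm_exp_ofReal_mul_I, one_mul, Complex.norm_real]
    rw [mul_comm]
    gcongr
    exact h0.trans (le_max_left _ _)
  · intro ht
    have hτ : t * 2 ^ (4 * K) ≠ 0 := mul_ne_zero ht (by positivity)
    have h1 := hb _ hε hK _ ((2 : ℝ) ^ K • x) hτ
    have ht0 : 0 < |t| := abs_pos.mpr ht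
    -- This is the square root of the dispersive bound at `τ = 2^{4K} t`; the Jacobian, at most
    -- `2^{Kn}`, then leaves `2^{-Kn}|t|^{-n/2}`.
    have h2 : ‖I‖ ≤ Real.sqrt C₁ * ((2 : ℝ) ^ (-(2 * (K : ℝ) * n)) * |t| ^ (-((n : ℝ) / 2))) := by
      refine le_of_sq_le_sq (h1.trans_eq ?_) (by positivity)
      rw [mul_pow, Real.sq_sqrt hC₁]
      congr 1
      rw [abs_mul, mul_pow, mul_inv, mul_comm, mul_pow]
      congr 1
      · rw [abs_of_pos (by positivity), ← Real.rpow_natCast (_ ^ _) 2, ← Real.rpow_mul zero_le_two,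
          ← pow_mul, ← Real.rpow_natCast, ← Real.rpow_neg zero_le_two]
        congr 1; push_cast; ring
      · rw [← Real.rpow_natCast (_ ^ _) 2, ← Real.rpow_mul ht0.le, ← Real.rpow_natCast,
          ← Real.rpow_neg ht0.le]
        congr 1; push_cast; ring
    have h3 : (2 : ℝ) ^ (-((K : ℝ) * n)) = 2 ^ ((K : ℝ) * n) * 2 ^ (-(2 * (K : ℝ) * n)) := by
      rw [← Real.rpow_add two_pos]; congr 1; ring
    calc ‖a ^ n‖ * ‖I‖ ≤ 2 ^ ((K : ℝ) * n) *
          (max C₀ (Real.sqrt C₁) * ((2 : ℝ) ^ (-(2 * (K : ℝ) * n)) * |t| ^ (-((n : ℝ) / 2)))) := by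
          gcongr
          refine h2.trans ?_
          gcongr
          exact le_max_right _ _
      _ = _ := by rw [h3]; ring

end Block

/-! ### The estimate on one block in terms of `distLpNorm` -/

section Block

open FourierTransform

variable {n : ℕ}

lemma distLpNorm_le {p : ℝ≥0∞} {u : 𝓢'(Rn n, ℂ)} {f : Rn n → ℂ} (hf : MemLp f p)
    (hu : Represents u f) : distLpNorm p u ≤ eLpNorm f p volume :=
  iInf_le_of_le f (iInf_le_of_le hf (iInf_le_of_le hu le_rfl))

lemma contDiff_blockSymbol {χ : Rn n → ℝ} (hχ : ContDiff ℝ (⊤ : ℕ∞) χ) (K : ℕ) (t : ℝ) :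
    ContDiff ℝ (⊤ : ℕ∞) (blockSymbol χ K t) := by
  refine (schrodinger4_symbol_hasTemperateGrowth (n := n) t).1.mul
    (Complex.ofRealCLM.contDiff.comp (hχ.comp ?_))
  fun_prop

lemma hasCompactSupport_blockSymbol {χ : Rn n → ℝ} (hχs : HasCompactSupport χ) (K : ℕ) (t : ℝ) :
    HasCompactSupport (blockSymbol χ K t) := by
  have h1 : HasCompactSupport fun ξ : Rn n => χ ((2 : ℝ) ^ (-(K : ℤ)) • ((2 * Real.pi) • ξ)) := by
    simp only [smul_smul]
    exact hχs.comp_smul (mul_ne_zero (zpow_ne_zero _ two_ne_zero)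
      (mul_ne_zero two_ne_zero Real.pi_ne_zero))
  exact (h1.comp_left (g := fun r : ℝ => (r : ℂ)) (by simp)).mul_left

/-- The Fourier multiplier with symbol `χ (2⁻ᴷ ξ)`. -/
def dilatedMultiplier (χ : Rn n → ℝ) (K : ℕ) : 𝓢'(Rn n, ℂ) →L[ℂ] 𝓢'(Rn n, ℂ) :=
  freqMultiplier fun ξ => (χ ((2 : ℝ) ^ (-(K : ℤ)) • ξ) : ℂ)

lemma dilatedSymbol_hasTemperateGrowth {χ : Rn n → ℝ} (hχ : ContDiff ℝ (⊤ : ℕ∞) χ)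
    (hχs : HasCompactSupport χ) (K : ℕ) :
    (fun ξ : Rn n => (χ ((2 : ℝ) ^ (-(K : ℤ)) • ((2 * Real.pi) • ξ)) : ℂ)).HasTemperateGrowth := by
  have h1 : χ.HasTemperateGrowth := hχs.hasTemperateGrowth hχ
  have h2 : (fun ξ : Rn n => (2 : ℝ) ^ (-(K : ℤ)) • ((2 * Real.pi) • ξ)).HasTemperateGrowth := by
    simp only [smul_smul]
    exact (((2 : ℝ) ^ (-(K : ℤ)) * (2 * Real.pi)) •
      ContinuousLinearMap.id ℝ (Rn n)).hasTemperateGrowth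
  exact (Function.Complex.hasTemperateGrowth_ofReal.comp h1).comp h2

/-- Dispersive estimate for a frequency localized distribution, given a bound for the kernel. -/
lemma distLpNorm_schrodinger4_le {χ : Rn n → ℝ} (hχ : ContDiff ℝ (⊤ : ℕ∞) χ)
    (hχs : HasCompactSupport χ) (hχ1 : ∀ x, |χ x| ≤ 1) {K : ℕ} {t : ℝ} {B : ℝ≥0}
    (hB0 : B ≠ 0) (hB : ∀ x, ‖𝓕⁻ (blockSymbol χ K t) x‖ ≤ B)
    {p r : ℝ≥0∞} [hpr : p.HolderConjugate r] (hp : 2 ≤ p) {u : 𝓢'(Rn n, ℂ)}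
    (hu : dilatedMultiplier χ K u = u) :
    distLpNorm p (schrodinger4 t u) ≤ (B : ℝ≥0∞) ^ (2 * deltaExp p) * distLpNorm r u := by
  set m : 𝓢(Rn n, ℂ) := (hasCompactSupport_blockSymbol hχs K t).toSchwartzMap
    (contDiff_blockSymbol hχ K t) with hm
  have hmcoe : (m : Rn n → ℂ) = blockSymbol χ K t := rfl
  have hUu : schrodinger4 t u = TemperedDistribution.fourierMultiplierCLM ℂ m u := by
    conv_lhs => rw [← hu]
    rw [hmcoe, schrodinger4, dilatedMultiplier, freqMultiplier, freqMultiplier,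
      TemperedDistribution.fourierMultiplierCLM_fourierMultiplierCLM_apply
        (dilatedSymbol_hasTemperateGrowth hχ hχs K) (schrodinger4_symbol_hasTemperateGrowth t)]
    congr 1
    congr 1
    funext ξ
    simp only [Pi.mul_apply, blockSymbol]
    rw [mul_comm]
  have hB' : ∀ x, ‖(𝓕⁻ m : 𝓢(Rn n, ℂ)) x‖ ≤ B := fun x => by
    rw [SchwartzMap.fourierInv_coe, hmcoe]; exact hB x
  have hm1 : ∀ ξ, ‖m ξ‖ ≤ 1 := fun ξ => by
    rw [hmcoe, blockSymbol, norm_mul, Complex.norm_exp_ofReal_mul_I, one_mul, Complex.norm_real]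
    exact hχ1 _
  have hr : 1 ≤ r := ENNReal.HolderConjugate.one_le r p
  have hM0 : (B : ℝ≥0∞) ^ (2 * deltaExp p) ≠ 0 := by
    have : (0 : ℝ≥0∞) < B := by exact_mod_cast pos_iff_ne_zero.mpr hB0
    exact (ENNReal.rpow_pos this ENNReal.coe_ne_top).ne'
  have hMt : (B : ℝ≥0∞) ^ (2 * deltaExp p) ≠ ∞ :=
    ENNReal.rpow_ne_top_of_ne_zero (by exact_mod_cast hB0) ENNReal.coe_ne_top
  -- Dividing by a finite nonzero factor reduces the claim to each representative in the infimum,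
  -- and makes it vacuous when there is none.
  rw [← ENNReal.div_le_iff' hM0 hMt]
  refine le_iInf fun f => le_iInf fun hf => le_iInf fun hrep => ?_
  rw [ENNReal.div_le_iff' hM0 hMt, hUu]
  have hbound := eLpNorm_convOp_le hB' (fun f hf => eLpNorm_convOp_two_le hm1 hf) hp hf
  refine (distLpNorm_le ⟨aestronglyMeasurable_convOp (SchwartzMap.continuous _) hf.1, ?_⟩
    (Represents.fourierMultiplierCLM hr hf hrep m)).trans hbound
  exact hbound.trans_lt (ENNReal.mul_lt_top hMt.lt_top hf.2)

end Block

/-! ### Besov weights and the choice between the two kernel bounds -/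

section Besov

open FourierTransform

variable {n : ℕ}

/-- A common factor on all blocks comes out of the `ℓ^q` norm. It may be `∞`, as happens at `t = 0`,
so the argument stays in `ℝ≥0∞`. -/
lemma besovNorm_le_mul {Φ : Rn n → ℝ} {s s' : ℝ} {p p' q : ℝ≥0∞} (hq : 1 ≤ q)
    {u v : 𝓢'(Rn n, ℂ)} {L : ℝ≥0∞}
    (hlow : distLpNorm p (lowFreq Φ u) ≤ L * distLpNorm p' (lowFreq Φ v))
    (hhigh : ∀ k : ℕ, (2 : ℝ≥0∞) ^ (((k : ℝ) + 1) * s) * distLpNorm p (lpProj Φ ((k : ℤ) + 1) u) ≤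
      L * ((2 : ℝ≥0∞) ^ (((k : ℝ) + 1) * s') * distLpNorm p' (lpProj Φ ((k : ℤ) + 1) v))) :
    besovNorm Φ s p q u ≤ L * besovNorm Φ s' p' q v := by
  unfold besovNorm
  split_ifs with h
  · refine max_le (hlow.trans (by gcongr; exact le_max_left _ _)) (iSup_le fun k => ?_)
    refine (hhigh k).trans ?_
    gcongr
    exact (le_iSup (fun k : ℕ => (2 : ℝ≥0∞) ^ (((k : ℝ) + 1) * s') *
      distLpNorm p' (lpProj Φ ((k : ℤ) + 1) v)) k).trans (le_max_right _ _)
  · have hq0 : 0 < q.toReal := ENNReal.toReal_pos (by positivity) h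
    have hL : L = (L ^ q.toReal) ^ (1 / q.toReal) := by
      rw [one_div, ENNReal.rpow_rpow_inv hq0.ne']
    conv_rhs => rw [hL, ← ENNReal.mul_rpow_of_nonneg _ _ (by positivity), mul_add,
      ← ENNReal.tsum_mul_left]
    refine ENNReal.rpow_le_rpow (add_le_add ?_ (ENNReal.tsum_le_tsum fun k => ?_)) (by positivity)
    · rw [← ENNReal.mul_rpow_of_nonneg _ _ hq0.le]
      exact ENNReal.rpow_le_rpow hlow hq0.le
    · have := ENNReal.rpow_le_rpow (hhigh k) hq0.le
      simpa only [ENNReal.mul_rpow_of_nonneg _ _ hq0.le, ← ENNReal.rpow_mul] using this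

/-- Low and high frequency bounds for one block combine to the kernel `k(t)`. -/
lemma exists_factor_le_decayKernel {δ s s' : ℝ} (hδ : 0 ≤ δ) (hs : -2 * n * δ ≤ s' - s) (t : ℝ)
    (K : ℕ) :
    ((2 : ℝ≥0∞) ^ ((K : ℝ) * s) * (2 : ℝ≥0∞) ^ (2 * (K : ℝ) * n * δ) ≤
      decayKernel n δ s s' t * (2 : ℝ≥0∞) ^ ((K : ℝ) * s')) ∨
    (t ≠ 0 ∧ (2 : ℝ≥0∞) ^ ((K : ℝ) * s) *
      ENNReal.ofReal (2 ^ (-(2 * (K : ℝ) * n * δ)) * |t| ^ (-(n * δ))) ≤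
      decayKernel n δ s s' t * (2 : ℝ≥0∞) ^ ((K : ℝ) * s')) := by
  have hnδ : 0 ≤ n * δ := by positivity
  have hK : (0 : ℝ) ≤ K := by positivity
  have h2 : ∀ x : ℝ, (2 : ℝ≥0∞) ^ x = ENNReal.ofReal (Real.exp (Real.log 2 * x)) := by
    intro x
    rw [← Real.rpow_def_of_pos two_pos, ← ENNReal.ofReal_rpow_of_pos two_pos, ENNReal.ofReal_ofNat]
  have h2r : ∀ x : ℝ, (2 : ℝ) ^ x = Real.exp (Real.log 2 * x) := Real.rpow_def_of_pos two_pos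
  have hlog2 : 0 ≤ Real.log 2 := Real.log_nonneg one_le_two
  unfold decayKernel
  rcases eq_or_ne t 0 with rfl | ht
  · left
    rw [if_pos (by simp)]
    rcases le_or_gt 0 (s' - s - 2 * n * δ) with ha | ha
    · rw [min_eq_right ha, mul_zero, ENNReal.rpow_zero, one_mul, h2, h2, h2,
        ← ENNReal.ofReal_mul (by positivity), ← Real.exp_add]
      refine ENNReal.ofReal_le_ofReal (Real.exp_le_exp.mpr ?_)
      nlinarith [mul_nonneg (mul_nonneg hlog2 hK) ha]
    -- Here the kernel is `∞` and the weight it multiplies is nonzero, so there is nothing to prove.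
    · rw [min_eq_left ha.le, abs_zero, ENNReal.ofReal_zero, ENNReal.zero_rpow_of_neg (by linarith),
        ENNReal.top_mul]
      · exact le_top
      · rw [h2]; simpa using Real.exp_pos _
  have ht0 : 0 < |t| := abs_pos.mpr ht
  have htr : ∀ x : ℝ, |t| ^ x = Real.exp (Real.log |t| * x) := Real.rpow_def_of_pos ht0
  have hte : ∀ x : ℝ, ENNReal.ofReal |t| ^ x = ENNReal.ofReal (Real.exp (Real.log |t| * x)) :=
    fun x => by rw [← htr, ENNReal.ofReal_rpow_of_pos ht0]
  split_ifs with h1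
  · have hL : Real.log |t| ≤ 0 := Real.log_nonpos ht0.le h1
    rcases le_or_gt 0 (s' - s - 2 * n * δ) with ha | ha
    · left
      rw [min_eq_right ha, mul_zero, ENNReal.rpow_zero, one_mul, h2, h2, h2,
        ← ENNReal.ofReal_mul (by positivity), ← Real.exp_add]
      refine ENNReal.ofReal_le_ofReal (Real.exp_le_exp.mpr ?_)
      nlinarith [mul_nonneg (mul_nonneg hlog2 hK) ha]
    · rw [min_eq_left ha.le]
      -- The two bounds cross at `2^{4K}|t| = 1`. The logarithmic gap to be shown nonnegative is a
      -- quarter of `4K log 2 + log|t|`, times `s' - s - 2nδ < 0` below the crossing and times `s' -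
      -- s + 2nδ ≥ 0` above it.
      rcases le_or_gt (4 * (Real.log 2 * K) + Real.log |t|) 0 with hc | hc
      · left
        rw [hte, h2, h2, h2, ← ENNReal.ofReal_mul (by positivity),
          ← ENNReal.ofReal_mul (by positivity), ← Real.exp_add, ← Real.exp_add]
        refine ENNReal.ofReal_le_ofReal (Real.exp_le_exp.mpr ?_)
        nlinarith [mul_nonneg (neg_nonneg.mpr hc) (neg_nonneg.mpr ha.le)]
      · right
        refine ⟨ht, ?_⟩
        rw [hte, h2, h2, h2r, htr, ← ENNReal.ofReal_mul (by positivity),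
          ← ENNReal.ofReal_mul (by positivity), ← Real.exp_add, ← Real.exp_add, ← Real.exp_add]
        refine ENNReal.ofReal_le_ofReal (Real.exp_le_exp.mpr ?_)
        have ha' : 0 ≤ s' - s + 2 * n * δ := by linarith
        nlinarith [mul_nonneg hc.le ha']
  · right
    refine ⟨ht, ?_⟩
    rw [hte, h2, h2, h2r, htr, ← ENNReal.ofReal_mul (by positivity),
      ← ENNReal.ofReal_mul (by positivity), ← Real.exp_add, ← Real.exp_add, ← Real.exp_add]
    refine ENNReal.ofReal_le_ofReal (Real.exp_le_exp.mpr ?_)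
    -- For `|t| > 1` the powers of `|t|` agree, and the gap is `K log 2` times this quantity.
    have ha' : 0 ≤ s' - s + 2 * n * δ := by linarith
    nlinarith [mul_nonneg (mul_nonneg hlog2 hK) ha']

/-- The dispersive estimate for one block, with the weights of the Besov norms. -/
lemma exists_weighted_distLpNorm_le (hn : 1 ≤ n) {χ : Rn n → ℝ} (hχ : ContDiff ℝ (⊤ : ℕ∞) χ)
    (hχs : HasCompactSupport χ) (hχ1 : ∀ x, |χ x| ≤ 1) :
    ∃ C : ℝ≥0, 1 ≤ C ∧ ∀ (p r : ℝ≥0∞) (s s' : ℝ) [p.HolderConjugate r], 2 ≤ p →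
      -2 * n * deltaExp p ≤ s' - s → ∀ (K : ℕ) (t : ℝ),
      (∀ η, χ η ≠ 0 → 1 / 16 ≤ ‖η‖ ^ 2 + ((2 : ℝ) ^ (2 * K))⁻¹) →
      ∀ u : 𝓢'(Rn n, ℂ), dilatedMultiplier χ K u = u →
      (2 : ℝ≥0∞) ^ ((K : ℝ) * s) * distLpNorm p (schrodinger4 t u) ≤
        C * decayKernel n (deltaExp p) s s' t * ((2 : ℝ≥0∞) ^ ((K : ℝ) * s') * distLpNorm r u) := by
  obtain ⟨C₀, hC₀, hb⟩ := exists_norm_fourierInv_blockSymbol_le hn hχ hχs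
  -- Taking `C ≥ 1` gives `C^{2δ} ≤ C` because `2δ ≤ 1`, so the constant does not depend on `p`.
  refine ⟨max 1 C₀.toNNReal, le_max_left _ _, fun p r s s' _ hp hs K t hK u hu => ?_⟩
  set C : ℝ≥0 := max 1 C₀.toNNReal with hC
  have hC1 : (1 : ℝ≥0∞) ≤ C := by exact_mod_cast le_max_left 1 C₀.toNNReal
  have hCC : C₀ ≤ C := (Real.le_coe_toNNReal C₀).trans (by exact_mod_cast le_max_right _ _)
  have hCpos : (0 : ℝ) < C := lt_of_lt_of_le one_pos (by exact_mod_cast hC1)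
  set δ := deltaExp p with hδdef
  have hinv : (p⁻¹).toReal ≤ 1 / 2 := by
    have h : p⁻¹ ≤ 2⁻¹ := ENNReal.inv_le_inv.mpr hp
    simpa using ENNReal.toReal_mono (by simp) h
  have hδ : 0 ≤ δ := by rw [hδdef, deltaExp]; linarith
  have hδ1 : 2 * δ ≤ 1 := by
    rw [hδdef, deltaExp]; linarith [ENNReal.toReal_nonneg (a := p⁻¹)]
  have hCδ : (C : ℝ≥0∞) ^ (2 * δ) ≤ C := by
    conv_rhs => rw [← ENNReal.rpow_one (C : ℝ≥0∞)]
    exact ENNReal.rpow_le_rpow_of_exponent_le hC1 hδ1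
  have hfinal : ∀ b : ℝ≥0∞, distLpNorm p (schrodinger4 t u) ≤ C * b * distLpNorm r u →
      (2 : ℝ≥0∞) ^ ((K : ℝ) * s) * b ≤ decayKernel n δ s s' t * (2 : ℝ≥0∞) ^ ((K : ℝ) * s') →
      (2 : ℝ≥0∞) ^ ((K : ℝ) * s) * distLpNorm p (schrodinger4 t u) ≤
        C * decayKernel n δ s s' t * ((2 : ℝ≥0∞) ^ ((K : ℝ) * s') * distLpNorm r u) := by
    intro b h1 h2
    calc (2 : ℝ≥0∞) ^ ((K : ℝ) * s) * distLpNorm p (schrodinger4 t u)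
        ≤ (2 : ℝ≥0∞) ^ ((K : ℝ) * s) * (C * b * distLpNorm r u) := by gcongr
      _ = C * ((2 : ℝ≥0∞) ^ ((K : ℝ) * s) * b) * distLpNorm r u := by ring
      _ ≤ C * (decayKernel n δ s s' t * (2 : ℝ≥0∞) ^ ((K : ℝ) * s')) * distLpNorm r u := by gcongr
      _ = _ := by ring
  have hblock : ∀ D : ℝ, 0 < D → (∀ x, ‖𝓕⁻ (blockSymbol χ K t) x‖ ≤ C₀ * D) →
      distLpNorm p (schrodinger4 t u) ≤ C * ENNReal.ofReal (D ^ (2 * δ)) * distLpNorm r u := by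
    intro D hD hx
    set B : ℝ≥0 := C * D.toNNReal with hB
    have hBD : (B : ℝ) = C * D := by rw [hB, NNReal.coe_mul, Real.coe_toNNReal _ hD.le]
    have h := distLpNorm_schrodinger4_le (r := r) hχ hχs hχ1 (K := K) (t := t) (B := B)
      (by
        have : (B : ℝ) ≠ 0 := by rw [hBD]; positivity
        exact_mod_cast this)
      (fun x => (hx x).trans (by rw [hBD]; gcongr)) hp hu
    refine h.trans ?_
    gcongr
    rw [hB, ENNReal.coe_mul, ENNReal.mul_rpow_of_nonneg _ _ (by positivity),
      ← ENNReal.ofReal_rpow_of_pos hD]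
    gcongr
    exact le_rfl
  rcases exists_factor_le_decayKernel hδ hs t K with h | ⟨ht, h⟩
  · refine hfinal _ ?_ h
    have := hblock _ (Real.rpow_pos_of_pos two_pos _) (fun x => (hb K t hK x).1)
    rw [← Real.rpow_mul zero_le_two, ← ENNReal.ofReal_rpow_of_pos two_pos,
      ENNReal.ofReal_ofNat] at this
    rwa [show (K : ℝ) * n * (2 * δ) = 2 * (K : ℝ) * n * δ by ring] at this
  · refine hfinal _ ?_ h
    have ht0 : 0 < |t| := abs_pos.mpr ht
    have := hblock _ (by positivity) (fun x => (hb K t hK x).2 ht)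
    rw [Real.mul_rpow (by positivity) (by positivity), ← Real.rpow_mul zero_le_two,
      ← Real.rpow_mul ht0.le] at this
    rwa [show -((K : ℝ) * n) * (2 * δ) = -(2 * (K : ℝ) * n * δ) by ring,
      show -((n : ℝ) / 2) * (2 * δ) = -(n * δ) by ring] at this

end Besov

/-! ### Fattened cutoffs and assembly of the blocks -/

section Main

variable {n : ℕ}

lemma freqMultiplier_freqMultiplier {a b : Rn n → ℂ}
    (ha : (fun ξ => a ((2 * Real.pi) • ξ)).HasTemperateGrowth)
    (hb : (fun ξ => b ((2 * Real.pi) • ξ)).HasTemperateGrowth) (u : 𝓢'(Rn n, ℂ)) :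
    freqMultiplier b (freqMultiplier a u) = freqMultiplier (fun ξ => a ξ * b ξ) u :=
  TemperedDistribution.fourierMultiplierCLM_fourierMultiplierCLM_apply ha hb u

lemma freqMultiplier_comm {a b : Rn n → ℂ}
    (ha : (fun ξ => a ((2 * Real.pi) • ξ)).HasTemperateGrowth)
    (hb : (fun ξ => b ((2 * Real.pi) • ξ)).HasTemperateGrowth) (u : 𝓢'(Rn n, ℂ)) :
    freqMultiplier b (freqMultiplier a u) = freqMultiplier a (freqMultiplier b u) := by
  rw [freqMultiplier_freqMultiplier ha hb, freqMultiplier_freqMultiplier hb ha]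
  simp only [mul_comm]

namespace IsLPCutoff

variable {Φ : Rn n → ℝ}

/-- On the sphere `‖x‖ = 2` the value follows by continuity along the ray through `x`. The boundary
case is needed where the dyadic bump meets its fattened version. -/
lemma eq_zero_of_two_le (hΦ : IsLPCutoff Φ) {x : Rn n} (hx : 2 ≤ ‖x‖) : Φ x = 0 := by
  by_contra h
  have hcl : IsClosed {c : ℝ | Φ (c • x) = 0} :=
    isClosed_eq (hΦ.smooth.continuous.comp (by fun_prop)) continuous_const
  have h1 : (1 : ℝ) ∈ closure {c : ℝ | Φ (c • x) = 0} := by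
    refine closure_mono (s := Set.Ioi 1) (fun c hc => hΦ.eq_zero _ ?_) (by simp)
    have hc' : 1 < c := hc
    rw [norm_smul, Real.norm_of_nonneg (by linarith)]
    nlinarith
  rw [hcl.closure_eq] at h1
  exact h (by simpa using h1)

lemma lpBump_ne_zero (hΦ : IsLPCutoff Φ) {x : Rn n} (hx : lpBump Φ x ≠ 0) : 1 / 2 ≤ ‖x‖ ∧ ‖x‖ ≤ 2 := by
  unfold lpBump at hx
  constructor
  · by_contra! h
    apply hx
    rw [hΦ.eq_one x (by linarith), hΦ.eq_one, sub_self]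
    rw [norm_smul, Real.norm_ofNat]; linarith
  · by_contra! h
    apply hx
    rw [hΦ.eq_zero x h, hΦ.eq_zero, sub_self]
    rw [norm_smul, Real.norm_ofNat]; linarith

lemma contDiff_smul (hΦ : IsLPCutoff Φ) (c : ℝ) : ContDiff ℝ (⊤ : ℕ∞) fun x => Φ (c • x) :=
  hΦ.smooth.comp (contDiff_const_smul c)

lemma hasCompactSupport_smul (hΦ : IsLPCutoff Φ) {c : ℝ} (hc : c ≠ 0) : HasCompactSupport fun x => Φ (c • x) :=
  hΦ.hasCompactSupport.comp_smul hc

/-- The low frequency projection of the flow is controlled by that of the datum. -/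
lemma exists_lowFreq_le (hΦ : IsLPCutoff Φ) (hn : 1 ≤ n) :
    ∃ C : ℝ≥0, ∀ (p r : ℝ≥0∞) (s s' : ℝ) [p.HolderConjugate r], 2 ≤ p →
      -2 * n * deltaExp p ≤ s' - s → ∀ (t : ℝ) (g : 𝓢'(Rn n, ℂ)),
      distLpNorm p (lowFreq Φ (schrodinger4 t g)) ≤
        C * decayKernel n (deltaExp p) s s' t * distLpNorm r (lowFreq Φ g) := by
  -- The cutoff `Φ(x/2)` equals `1` on the support of `Φ`, so it reproduces the low frequency part.
  obtain ⟨C, -, hC⟩ := exists_weighted_distLpNorm_le hn (hΦ.contDiff_smul (1 / 2))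
    (hΦ.hasCompactSupport_smul (by norm_num : (1 / 2 : ℝ) ≠ 0))
    (fun x => abs_le.mpr ⟨by linarith [(hΦ.mem_Icc ((1 / 2 : ℝ) • x)).1],
      (hΦ.mem_Icc ((1 / 2 : ℝ) • x)).2⟩)
  refine ⟨C, fun p r s s' _ hp hs t g => ?_⟩
  have hlow := hΦ.lowFreq_symbol_hasTemperateGrowth
  have hcomm : lowFreq Φ (schrodinger4 t g) = schrodinger4 t (lowFreq Φ g) :=
    freqMultiplier_comm (schrodinger4_symbol_hasTemperateGrowth t) hlow g
  have hrep : dilatedMultiplier (fun x => Φ ((1 / 2 : ℝ) • x)) 0 (lowFreq Φ g) = lowFreq Φ g := by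
    unfold dilatedMultiplier lowFreq
    rw [freqMultiplier_freqMultiplier hlow (dilatedSymbol_hasTemperateGrowth
      (hΦ.contDiff_smul (1 / 2)) (hΦ.hasCompactSupport_smul (by norm_num)) 0)]
    congr 2
    funext ξ
    rw [← Complex.ofReal_mul]
    congr 1
    rcases le_or_gt ‖ξ‖ 2 with h | h
    · simp only [Nat.cast_zero, neg_zero, zpow_zero, one_smul]
      rw [hΦ.eq_one ((1 / 2 : ℝ) • ξ), mul_one]
      rw [norm_smul, Real.norm_of_nonneg (by norm_num)]
      linarith
    · rw [hΦ.eq_zero ξ h, zero_mul]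
  -- At `K = 0` one has `ε = 1`: the Laplacian term keeps the phase nondegenerate at the origin, and
  -- the weights `2^{Ks}`, `2^{Ks'}` are `1`.
  have h := hC p r s s' hp hs 0 t (fun η _ => by
    simp only [mul_zero, pow_zero, inv_one]; nlinarith [sq_nonneg ‖η‖]) (lowFreq Φ g) hrep
  rw [hcomm]
  simpa using h

/-- The dyadic pieces of the flow are controlled by those of the datum. -/
lemma exists_lpProj_le (hΦ : IsLPCutoff Φ) (hn : 1 ≤ n) :
    ∃ C : ℝ≥0, ∀ (p r : ℝ≥0∞) (s s' : ℝ) [p.HolderConjugate r], 2 ≤ p →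
      -2 * n * deltaExp p ≤ s' - s → ∀ (t : ℝ) (g : 𝓢'(Rn n, ℂ)) (k : ℕ),
      (2 : ℝ≥0∞) ^ (((k : ℝ) + 1) * s) *
          distLpNorm p (lpProj Φ ((k : ℤ) + 1) (schrodinger4 t g)) ≤
        C * decayKernel n (deltaExp p) s s' t *
          ((2 : ℝ≥0∞) ^ (((k : ℝ) + 1) * s') * distLpNorm r (lpProj Φ ((k : ℤ) + 1) g)) := by
  -- This fattened bump equals `1` for `1/2 ≤ ‖x‖ ≤ 2`, where `ψ` lives, and vanishes for `‖x‖ <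
  -- 1/4`; hence the constant `1/16` in the nondegeneracy condition.
  set χ : Rn n → ℝ := fun x => Φ ((1 / 2 : ℝ) • x) - Φ ((4 : ℝ) • x) with hχdef
  have hχ : ContDiff ℝ (⊤ : ℕ∞) χ := (hΦ.contDiff_smul (1 / 2)).sub (hΦ.contDiff_smul 4)
  have hχs : HasCompactSupport χ :=
    (hΦ.hasCompactSupport_smul (by norm_num)).sub (hΦ.hasCompactSupport_smul (by norm_num))
  have hχ1 : ∀ x, |χ x| ≤ 1 := fun x => by
    have h1 := hΦ.mem_Icc ((1 / 2 : ℝ) • x)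
    have h2 := hΦ.mem_Icc ((4 : ℝ) • x)
    exact abs_le.mpr ⟨by simp only [hχdef]; linarith [h1.1, h2.2],
      by simp only [hχdef]; linarith [h1.2, h2.1]⟩
  obtain ⟨C, -, hC⟩ := exists_weighted_distLpNorm_le hn hχ hχs hχ1
  refine ⟨C, fun p r s s' _ hp hs t g k => ?_⟩
  have hproj := hΦ.lpProj_symbol_hasTemperateGrowth ((k : ℤ) + 1)
  have hcomm : lpProj Φ ((k : ℤ) + 1) (schrodinger4 t g) =
      schrodinger4 t (lpProj Φ ((k : ℤ) + 1) g) :=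
    freqMultiplier_comm (schrodinger4_symbol_hasTemperateGrowth t) hproj g
  have hrep : dilatedMultiplier χ (k + 1) (lpProj Φ ((k : ℤ) + 1) g) =
      lpProj Φ ((k : ℤ) + 1) g := by
    unfold dilatedMultiplier lpProj
    rw [freqMultiplier_freqMultiplier hproj (dilatedSymbol_hasTemperateGrowth hχ hχs (k + 1))]
    congr 2
    funext ξ
    rw [← Complex.ofReal_mul, Nat.cast_add, Nat.cast_one]
    congr 1
    set x := (2 : ℝ) ^ (-((k : ℤ) + 1)) • ξ
    by_cases hx : lpBump Φ x = 0
    · rw [hx, zero_mul]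
    · obtain ⟨h1, h2⟩ := hΦ.lpBump_ne_zero hx
      have e1 : Φ ((1 / 2 : ℝ) • x) = 1 := hΦ.eq_one _ (by
        rw [norm_smul, Real.norm_of_nonneg (by norm_num)]; linarith)
      have e2 : Φ ((4 : ℝ) • x) = 0 := hΦ.eq_zero_of_two_le (by
        rw [norm_smul, Real.norm_of_nonneg (by norm_num)]; linarith)
      simp only [hχdef, e1, e2, sub_zero, mul_one]
  have hsupp : ∀ η, χ η ≠ 0 → 1 / 16 ≤ ‖η‖ ^ 2 + ((2 : ℝ) ^ (2 * (k + 1)))⁻¹ := by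
    intro η hη
    have h14 : 1 / 4 ≤ ‖η‖ := by
      by_contra! h
      apply hη
      simp only [hχdef]
      rw [hΦ.eq_one, hΦ.eq_one, sub_self] <;>
      · rw [norm_smul, Real.norm_of_nonneg (by norm_num)]; linarith
    have : (0 : ℝ) ≤ ((2 : ℝ) ^ (2 * (k + 1)))⁻¹ := by positivity
    nlinarith
  have h := hC p r s s' hp hs (k + 1) t hsupp _ hrep
  rw [hcomm]
  simpa only [Nat.cast_add, Nat.cast_one] using h

end IsLPCutoff

end Main
end

theorem mainTheorem7 (n : ℕ) (hn : 1 ≤ n) (Φ : Rn n → ℝ) (hΦ : IsLPCutoff Φ) :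
    ∃ C : ℝ≥0, ∀ (p p' q : ℝ≥0∞) (s s' : ℝ),
      2 ≤ p → p⁻¹ + p'⁻¹ = 1 → 1 ≤ q → -2 * n * deltaExp p ≤ s' - s →
      ∀ (t : ℝ) (g : 𝓢'(Rn n, ℂ)),
        besovNorm Φ s p q (schrodinger4 t g) ≤
          C * decayKernel n (deltaExp p) s s' t * besovNorm Φ s' p' q g := by
  obtain ⟨C₁, h₁⟩ := hΦ.exists_lowFreq_le hn
  obtain ⟨C₂, h₂⟩ := hΦ.exists_lpProj_le hn
  refine ⟨max C₁ C₂, fun p p' q s s' hp hpp' hq hs t g => ?_⟩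
  have : p.HolderConjugate p' := ENNReal.holderConjugate_iff.mpr hpp'
  refine besovNorm_le_mul hq ((h₁ p p' s s' hp hs t g).trans ?_)
    fun k => (h₂ p p' s s' hp hs t g k).trans ?_
  · gcongr; exact le_max_left _ _
  · gcongr; exact le_max_right _ _
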